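/- Let $N\ge 1$ be an integer, let $0\le s<t\le 1$ and $m\in(0,+\infty)$. For a Lebesgue measurable set $E\subset\mathbb R^N$ and $\alpha\in(0,1)$ let $$P_\alpha(E)=\int_E\int_{\mathbb R^N\setminus E}\frac{dy\,dx}{|x-y|^{N+\alpha}}\in[0,+\infty],$$ let $$P(E)=\sup\Big\{\int_E \operatorname{div}\varphi\,dx:\ \varphi\in C^1_c(\mathbb R^N;\mathbb R^N),\ |\varphi|\le 1\Big\}\in[0,+\infty]$$ be the classical perimeter, and let $\omega_N$ be the volume of the unit ball of $\mathbb R^N$. Put $A_t(E)=(1-t)P_t(E)$ if $t<1$ and $A_1(E)=N\omega_N P(E)$; put $R_s(E)=sP_s(E)$ if $s>0$ and $R_0(E)=N\omega_N|E|$. Define $$\mathcal F_{s,t}(E)=A_t(E)-R_s(E)\quad\text{if }A_t(E)<+\infty,\qquad \mathcal F_{s,t}(E)=+\infty\quad\text{if }A_t(E)=+\infty .$$ Let $F\subset\mathbb R^N$ be a volume-constrained minimizer of $\mathcal F_{s,t}$, i.e. $F$ is Lebesgue measurable, $|F|=m$ and $$\mathcal F_{s,t}(F)=\inf\{\mathcal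 F_{s,t}(E):\ E\subset\mathbb R^N\text{ Lebesgue measurable},\ |E|=m\}.$$ Then: 1. $F$ is essentially bounded: there is $R\in\mathbb R$ such that $|F\setminus B(0,R)|=0$. 2. If $t=1$, then $F$ is also essentially connected: there are no disjoint Lebesgue measurable sets $F_1,F_2$ of positive measure with $F=F_1\cup F_2$ and $P(F)=P(F_1)+P(F_2)$. -/

import Mathlib

open MeasureTheory
open scoped ENNReal

noncomputable section

namespace FracPerimeter

variable {N : ℕ}

/-- The fractional perimeter
`P_α(E) = ∫_E ∫_{Eᶜ} |x - y|^{-(N + α)} dy dx`, with values in `[0, ∞]`. -/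
def fracPerimeter (α : ℝ) (E : Set (EuclideanSpace ℝ (Fin N))) : ℝ≥0∞ :=
  ∫⁻ x in E, ∫⁻ y in Eᶜ, ENNReal.ofReal (1 / ‖x - y‖ ^ ((N : ℝ) + α))

/-- The divergence of a vector field on `ℝ^N`, the sum of the `∂_i φ_i`. -/
def divergence (φ : EuclideanSpace ℝ (Fin N) → EuclideanSpace ℝ (Fin N))
    (x : EuclideanSpace ℝ (Fin N)) : ℝ :=
  ∑ i : Fin N, (fderiv ℝ φ x (EuclideanSpace.single i 1)) i

/-- The classical (De Giorgi) perimeter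
`P(E) = sup {∫_E div φ : φ ∈ C¹_c(ℝ^N; ℝ^N), |φ| ≤ 1}`, with values in `[0, ∞]`. -/
def perimeter (E : Set (EuclideanSpace ℝ (Fin N))) : ℝ≥0∞ :=
  ⨆ (φ : EuclideanSpace ℝ (Fin N) → EuclideanSpace ℝ (Fin N)) (_ : ContDiff ℝ 1 φ)
    (_ : HasCompactSupport φ) (_ : ∀ x, ‖φ x‖ ≤ 1),
    ENNReal.ofReal (∫ x in E, divergence φ x)

/-- The constant `N ω_N`, where `ω_N` is the volume of the unit ball of `ℝ^N`. -/
def sphereConst (N : ℕ) : ℝ≥0∞ :=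
  (N : ℝ≥0∞) * volume (Metric.ball (0 : EuclideanSpace ℝ (Fin N)) 1)

/-- The attractive term of the energy: `(1 - t) P_t(E)` if `t < 1`, and `N ω_N P(E)` if `t = 1`. -/
def attractive (t : ℝ) (E : Set (EuclideanSpace ℝ (Fin N))) : ℝ≥0∞ :=
  open Classical in
  if t = 1 then sphereConst N * perimeter E else ENNReal.ofReal (1 - t) * fracPerimeter t E

/-- The repulsive term of the energy: `s P_s(E)` if `s > 0`, and `N ω_N |E|` if `s = 0`. -/
def repulsive (s : ℝ) (E : Set (EuclideanSpace ℝ (Fin N))) : ℝ≥0∞ :=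
  open Classical in
  if s = 0 then sphereConst N * volume E else ENNReal.ofReal s * fracPerimeter s E

/-- The energy `F_{s,t}(E)`, attractive term minus repulsive term. It is `+∞` on the sets whose
attractive term is infinite (this settles the undefined difference `∞ - ∞`; if `|E| < ∞` and the
attractive term is finite, then so is the repulsive one). -/
def energy (s t : ℝ) (E : Set (EuclideanSpace ℝ (Fin N))) : EReal :=
  open Classical in
  if attractive t E = ∞ then ⊤ else (attractive t E : EReal) - (repulsive s E : EReal)

/-- The isovolumetric function `m ↦ inf {F_{s,t}(E) : E Lebesgue measurable, |E| = m}`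
(`NullMeasurableSet` is Lebesgue measurability). -/
def isovolumetric (N : ℕ) (s t m : ℝ) : EReal :=
  ⨅ (E : Set (EuclideanSpace ℝ (Fin N))) (_ : NullMeasurableSet E volume)
    (_ : volume E = ENNReal.ofReal m), energy s t E

/-- `F` is a minimizer of `F_{s,t}` among the Lebesgue measurable sets of volume `m`. -/
structure IsVolumeMinimizer (s t m : ℝ) (F : Set (EuclideanSpace ℝ (Fin N))) : Prop where
  nullMeasurableSet : NullMeasurableSet F volume
  volume_eq : volume F = ENNReal.ofReal m
  energy_eq : energy s t F = isovolumetric N s t m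

/-- `F` is contained in a ball up to a Lebesgue null set. -/
def EssBounded (F : Set (EuclideanSpace ℝ (Fin N))) : Prop :=
  ∃ R : ℝ, volume (F \ Metric.ball 0 R) = 0

/-- `F` cannot be partitioned into two measurable sets of positive measure whose perimeters add
up to the perimeter of `F`. -/
def EssConnected (F : Set (EuclideanSpace ℝ (Fin N))) : Prop :=
  ¬ ∃ F₁ F₂ : Set (EuclideanSpace ℝ (Fin N)),
    NullMeasurableSet F₁ volume ∧ NullMeasurableSet F₂ volume ∧
    F₁ ∪ F₂ = F ∧ Disjoint F₁ F₂ ∧ 0 < volume F₁ ∧ 0 < volume F₂ ∧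
    perimeter F = perimeter F₁ + perimeter F₂

end FracPerimeter

end

/-! Boundedness is a density argument. Let u(ρ) = |F \ B_ρ| and cut F at a radius r in [ρ, ρ + d]
into E = F ∩ B_r and G = F \ B_r. A well chosen r makes the cut cheap: A_t(E) + A_t(G) ≤ A_t(F) +
(C/d) u(ρ). For t = 1 this comes from a radius where the volume of F ∩ B_r grows slowly, for t < 1
from averaging the interaction of the two pieces over r (`exists_attractive_cut_le`). Discarding G
and dilating E back to volume m gives a competitor. Since A_t grows at most like the volume under
dilations and R_s is subadditive and does not decrease, minimality bounds A_t(F) by (m/(m - |G|))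
A_t(E) + R_s(G) (`IsVolumeMinimizer.attractive_le_of_cut`).

Because s < t, interpolation absorbs R_s(G) into A_t(G)/2 + C|G| (`exists_repulsive_le`), and an
isoperimetric inequality gives A_t(G) ≥ c|G|^β with β < 1 when |G| is small
(`exists_rpow_le_attractive`). Terms linear in |G| are then negligible, and what remains is u(ρ +
d)^β ≤ (C/d) u(ρ) for large ρ. De Giorgi iteration makes u vanish at a finite radius
(`exists_eq_zero_of_rpow_le`).

For connectedness at t = 1, suppose F = A ∪ B with P(F) = P(A) + P(B). If s > 0, boundedness allows
B to be translated far away; the perimeter does not increase, while the interaction of the two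
pieces tends to 0. Since P_s(A ∪ B) = P_s(A) + P_s(B) - 2 I(A, B) and I(A, B) > 0, the repulsive
term eventually increases strictly, against minimality
(`IsVolumeMinimizer.perimeter_union_ne_of_pos`). If s = 0 the repulsive term is constant at fixed
volume, so F minimizes the perimeter; dilating A and B separately to volume m shows that each has a
strictly larger ratio of perimeter to volume than F, which is incompatible with additivity
(`IsVolumeMinimizer.perimeter_union_ne_of_zero`).

The link between P and P_α is the estimate |E \ (E + h)| ≤ |h| P(E), integrated against the kernel;
it also replaces the classical isoperimetric inequality by a fractional one with an elementary
proof. -/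

noncomputable section

namespace FracPerimeter

variable {N : ℕ}

/-! ### Kernels, interactions and the fractional perimeter. -/

/-- Euclidean space `ℝ^N`. -/
abbrev Euc (N : ℕ) := EuclideanSpace ℝ (Fin N)

/-- The kernel `|z|^{-(N + α)}`. -/
def kernel (α : ℝ) (z : Euc N) : ℝ≥0∞ := ENNReal.ofReal (1 / ‖z‖ ^ ((N : ℝ) + α))

/-- The interaction `∫_A ∫_B |x - y|^{-(N + α)} dy dx`. -/
def interaction (α : ℝ) (A B : Set (Euc N)) : ℝ≥0∞ := ∫⁻ x in A, ∫⁻ y in B, kernel α (x - y)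

/-- The integral of `min(|z|, 1) |z|^{-(N + α)}`. -/
def truncConst (N : ℕ) (α : ℝ) : ℝ≥0∞ :=
  ∫⁻ z : Euc N, ENNReal.ofReal (min ‖z‖ 1) * kernel α z

lemma fracPerimeter_eq_interaction (α : ℝ) (E : Set (Euc N)) :
    fracPerimeter α E = interaction α E Eᶜ := rfl

@[fun_prop]
lemma measurable_kernel (α : ℝ) : Measurable (kernel α : Euc N → ℝ≥0∞) := by
  unfold kernel; fun_prop

lemma kernel_neg (α : ℝ) (z : Euc N) : kernel α (-z) = kernel α z := by simp [kernel]

lemma kernel_pos {α : ℝ} {z : Euc N} (hz : z ≠ 0) : 0 < kernel α z := by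
  have := norm_pos_iff.2 hz
  unfold kernel
  rw [ENNReal.ofReal_pos]
  positivity

/-- In polar coordinates the integrand is r^(-α) on (0, 1], integrable since α < 1, and r^(-1-α)
beyond 1, integrable since α > 0. -/
lemma truncConst_lt_top (hN : 1 ≤ N) {α : ℝ} (h0 : 0 < α) (h1 : α < 1) :
    truncConst N α < ∞ := by
  have : Nonempty (Fin N) := ⟨⟨0, hN⟩⟩
  have : Nontrivial (Euc N) := inferInstance
  set f : ℝ → ℝ := fun r => min r 1 * (1 / r ^ ((N : ℝ) + α)) with hf
  have key : Integrable (fun z : Euc N => f ‖z‖) volume := by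
    rw [integrable_fun_norm_addHaar]
    simp only [finrank_euclideanSpace, Fintype.card_fin, smul_eq_mul]
    rw [← Set.Ioc_union_Ioi_eq_Ioi (zero_le_one (α := ℝ))]
    have hpow : ∀ r : ℝ, 0 < r → r ^ (N - 1) * (1 / r ^ ((N : ℝ) + α)) = r ^ (-1 - α) := by
      intro r hr
      rw [one_div, ← Real.rpow_neg hr.le, ← Real.rpow_natCast, ← Real.rpow_add hr]
      congr 1
      rw [Nat.cast_sub hN]; push_cast; ring
    refine IntegrableOn.union ?_ ?_
    · have : IntegrableOn (fun r : ℝ => r ^ (-α)) (Set.Ioc 0 1) := by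
        rw [← intervalIntegrable_iff_integrableOn_Ioc_of_le zero_le_one]
        exact intervalIntegral.intervalIntegrable_rpow' (by linarith)
      refine this.congr_fun (fun r hr => ?_) measurableSet_Ioc
      have h := hpow r hr.1
      simp only [hf, min_eq_left hr.2]
      rw [mul_left_comm, h, ← Real.rpow_one_add' hr.1.le (by linarith)]
      congr 1; ring
    · have : IntegrableOn (fun r : ℝ => r ^ (-1 - α)) (Set.Ioi 1) :=
        integrableOn_Ioi_rpow_of_lt (by linarith) one_pos
      refine this.congr_fun (fun r hr => ?_) measurableSet_Ioi
      have hr : (1 : ℝ) < r := hr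
      simp only [hf, min_eq_right hr.le, one_mul]
      exact (hpow r (by linarith)).symm
  have := key.lintegral_lt_top
  refine lt_of_eq_of_lt ?_ this
  unfold truncConst kernel
  refine lintegral_congr fun z => ?_
  rw [← ENNReal.ofReal_mul (by positivity)]

/-- The truncated kernel dominates the kernel away from the diagonal, where it is integrable. -/
lemma lintegral_kernel_compl_ball (α : ℝ) {δ : ℝ} (hδ : 0 < δ) (hδ1 : δ ≤ 1) :
    ∫⁻ z in {z : Euc N | δ ≤ ‖z‖}, kernel α z ≤ ENNReal.ofReal δ⁻¹ * truncConst N α := by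
  unfold truncConst
  rw [← lintegral_const_mul _ (by fun_prop)]
  refine (setLIntegral_mono'
    (g := fun z => ENNReal.ofReal δ⁻¹ * (ENNReal.ofReal (min ‖z‖ 1) * kernel α z))
    (measurableSet_le measurable_const measurable_norm) fun z hz => ?_).trans
    (setLIntegral_le_lintegral _ _)
  rw [← mul_assoc, ← ENNReal.ofReal_mul (by positivity)]
  refine le_mul_of_one_le_left' ?_
  rw [← ENNReal.ofReal_one]
  refine ENNReal.ofReal_le_ofReal ?_
  rw [inv_mul_eq_div, one_le_div hδ]
  exact le_min hz hδ1

lemma kernel_le_mul_kernel {s t δ : ℝ} (hst : s ≤ t) (hs : 0 < s) {z : Euc N} (hz : ‖z‖ ≤ δ) :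
    kernel s z ≤ ENNReal.ofReal (δ ^ (t - s)) * kernel t z := by
  unfold kernel
  have hδ : 0 ≤ δ := (norm_nonneg z).trans hz
  rw [← ENNReal.ofReal_mul (by positivity)]
  refine ENNReal.ofReal_le_ofReal ?_
  rcases eq_or_ne z 0 with rfl | h
  -- Division by zero gives the kernel the value 0 at the origin.
  · have h0 : (N : ℝ) + s ≠ 0 := by positivity
    rw [norm_zero, Real.zero_rpow h0, div_zero]
    positivity
  · have hz0 := norm_pos_iff.2 h
    have : ‖z‖ ^ ((N : ℝ) + t) = ‖z‖ ^ (t - s) * ‖z‖ ^ ((N : ℝ) + s) := by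
      rw [← Real.rpow_add hz0]; congr 1; ring
    rw [this, mul_one_div, div_le_div_iff₀ (by positivity) (by positivity), one_mul]
    gcongr

lemma lintegral_kernel_swap (α : ℝ) (μ ν : Measure (Euc N)) [SFinite μ] [SFinite ν] :
    ∫⁻ x, ∫⁻ y, kernel α (x - y) ∂ν ∂μ = ∫⁻ x, ∫⁻ y, kernel α (x - y) ∂μ ∂ν := by
  rw [lintegral_lintegral_swap (by fun_prop)]
  refine lintegral_congr fun x => lintegral_congr fun y => ?_
  rw [← kernel_neg, neg_sub]

lemma interaction_comm (α : ℝ) (A B : Set (Euc N)) : interaction α A B = interaction α B A :=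
  lintegral_kernel_swap α _ _

lemma interaction_congr (α : ℝ) {A A' B B' : Set (Euc N)} (hA : A =ᵐ[volume] A')
    (hB : B =ᵐ[volume] B') : interaction α A B = interaction α A' B' := by
  unfold interaction
  rw [Measure.restrict_congr_set hA, Measure.restrict_congr_set hB]

lemma interaction_union_left (α : ℝ) {A A' : Set (Euc N)} (hA' : MeasurableSet A')
    (h : Disjoint A A') (B : Set (Euc N)) :
    interaction α (A ∪ A') B = interaction α A B + interaction α A' B :=
  lintegral_union hA' h

lemma interaction_union_right (α : ℝ) {B B' : Set (Euc N)} (hB' : MeasurableSet B')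
    (h : Disjoint B B') (A : Set (Euc N)) :
    interaction α A (B ∪ B') = interaction α A B + interaction α A B' := by
  simp_rw [interaction_comm α A, interaction_union_left α hB' h]

lemma fracPerimeter_congr (α : ℝ) {E E' : Set (Euc N)} (h : E =ᵐ[volume] E') :
    fracPerimeter α E = fracPerimeter α E' :=
  interaction_congr α h h.compl

/-- Each of P(A) and P(B) counts the interaction of A with B once, whereas P(A ∪ B) omits it. The
sum form avoids subtraction of possibly infinite values. -/
lemma fracPerimeter_union (α : ℝ) {A B : Set (Euc N)} (hA : MeasurableSet A)
    (hB : MeasurableSet B) (h : Disjoint A B) :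
    fracPerimeter α (A ∪ B) + 2 * interaction α A B = fracPerimeter α A + fracPerimeter α B := by
  simp only [fracPerimeter_eq_interaction]
  have hAc : Aᶜ = (A ∪ B)ᶜ ∪ B := by
    ext x; have hx := fun hx : x ∈ A => Set.disjoint_left.1 h hx; simp; tauto
  have hBc : Bᶜ = (A ∪ B)ᶜ ∪ A := by
    ext x; have hx := fun hx : x ∈ A => Set.disjoint_left.1 h hx; simp; tauto
  have h1 : interaction α A Aᶜ = interaction α A (A ∪ B)ᶜ + interaction α A B := by
    rw [hAc, interaction_union_right α hB]
    exact Set.disjoint_left.2 fun x hx hx' => hx (Or.inr hx')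
  have h2 : interaction α B Bᶜ = interaction α B (A ∪ B)ᶜ + interaction α A B := by
    rw [hBc, interaction_union_right α hA, interaction_comm α B A]
    exact Set.disjoint_left.2 fun x hx hx' => hx (Or.inl hx')
  rw [h1, h2, interaction_union_left α hB h]
  ring

lemma fracPerimeter_union_le (α : ℝ) {A B : Set (Euc N)} (hA : MeasurableSet A)
    (hB : MeasurableSet B) (h : Disjoint A B) :
    fracPerimeter α (A ∪ B) ≤ fracPerimeter α A + fracPerimeter α B :=
  le_self_add.trans_eq (fracPerimeter_union α hA hB h)

/-- The fractional perimeter as an average of the measures of `E \ (E + z)`. -/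
lemma fracPerimeter_eq_lintegral (α : ℝ) {E : Set (Euc N)} (hE : MeasurableSet E) :
    fracPerimeter α E = ∫⁻ z, kernel α z * volume (E \ (fun x => x - z) ⁻¹' E) := by
  have h1 : ∀ x : Euc N, ∫⁻ y in Eᶜ, kernel α (x - y)
      = ∫⁻ z, kernel α z * Eᶜ.indicator 1 (x - z) := by
    intro x
    rw [← lintegral_indicator hE.compl,
      ← lintegral_sub_left_eq_self (μ := (volume : Measure (Euc N))) _ x]
    refine lintegral_congr fun y => ?_
    by_cases hy : x - y ∈ E <;> simp [hy]
  have hm : Measurable (Eᶜ.indicator (1 : Euc N → ℝ≥0∞)) := measurable_one.indicator hE.compl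
  rw [fracPerimeter_eq_interaction]
  unfold interaction
  simp_rw [h1]
  rw [lintegral_lintegral_swap (by fun_prop)]
  refine lintegral_congr fun z => ?_
  rw [lintegral_const_mul _ (by fun_prop)]
  congr 1
  have : (fun x : Euc N => Eᶜ.indicator (1 : Euc N → ℝ≥0∞) (x - z))
      = ((fun x => x - z) ⁻¹' E)ᶜ.indicator 1 := by
    ext x; by_cases hx : x - z ∈ E <;> simp [hx]
  have hmz : MeasurableSet ((fun x : Euc N => x - z) ⁻¹' E) := by measurability
  rw [this, lintegral_indicator_one hmz.compl, Measure.restrict_apply hmz.compl, Set.inter_comm]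
  rfl

/-- Displacements |z| < δ are controlled by the more singular kernel, with a factor that is small
with δ when s < t; for |z| ≥ δ the kernel is integrable and |E \ (E + z)| ≤ |E|. -/
lemma fracPerimeter_interp {s t δ : ℝ} (hs : 0 < s) (hst : s ≤ t) (hδ : 0 < δ) (hδ1 : δ ≤ 1)
    {E : Set (Euc N)} (hE : MeasurableSet E) :
    fracPerimeter s E ≤ ENNReal.ofReal (δ ^ (t - s)) * fracPerimeter t E
      + ENNReal.ofReal δ⁻¹ * truncConst N s * volume E := by
  rw [fracPerimeter_eq_lintegral s hE, fracPerimeter_eq_lintegral t hE]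
  have hm : MeasurableSet {z : Euc N | δ ≤ ‖z‖} := measurableSet_le measurable_const measurable_norm
  rw [← lintegral_const_mul' _ _ ENNReal.ofReal_ne_top]
  calc ∫⁻ z, kernel s z * volume (E \ (fun x => x - z) ⁻¹' E)
      ≤ ∫⁻ z, (ENNReal.ofReal (δ ^ (t - s)) * (kernel t z * volume (E \ (fun x => x - z) ⁻¹' E))
        + {z : Euc N | δ ≤ ‖z‖}.indicator (kernel s) z * volume E) := by
        refine lintegral_mono fun z => ?_
        dsimp only
        rcases le_or_gt δ ‖z‖ with h | h
        · refine le_add_of_nonneg_of_le zero_le ?_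
          rw [Set.indicator_of_mem (by exact h)]
          gcongr
          exact Set.sdiff_subset
        · refine le_add_of_le_of_nonneg ?_ zero_le
          rw [← mul_assoc]
          gcongr
          exact kernel_le_mul_kernel hst hs h.le
    _ ≤ _ := by
        rw [lintegral_add_right _ (((measurable_kernel s).indicator hm).mul_const _)]
        gcongr
        rw [lintegral_mul_const _ ((measurable_kernel s).indicator hm), lintegral_indicator hm]
        gcongr
        exact lintegral_kernel_compl_ball s hδ hδ1

/-- An isoperimetric inequality for the fractional perimeter. -/
lemma le_fracPerimeter {α ρ : ℝ} (hα : 0 < α) {E : Set (Euc N)}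
    (hE : MeasurableSet E) (hvol : 2 * volume E ≤ volume (Metric.ball (0 : Euc N) ρ)) :
    ENNReal.ofReal (1 / ρ ^ ((N : ℝ) + α)) * volume E * volume E ≤ fracPerimeter α E := by
  have hfin : volume E ≠ ∞ := by
    intro h; rw [h] at hvol
    exact absurd (hvol.trans_lt measure_ball_lt_top) (by simp)
  rw [← setLIntegral_const]
  refine setLIntegral_mono' hE fun x hx => ?_
  -- At least half of the ball about x lies outside E, and there the kernel is at least ρ^(-(N +
  -- α)).
  have h1 : volume E ≤ volume (Metric.ball x ρ \ E) := by
    refine le_trans ?_ le_measure_sdiff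
    rw [Measure.addHaar_ball_center]
    exact ENNReal.le_sub_of_add_le_right hfin (by rwa [← two_mul])
  have hm : MeasurableSet (Metric.ball x ρ \ E) := measurableSet_ball.diff hE
  calc _ ≤ ENNReal.ofReal (1 / ρ ^ ((N : ℝ) + α)) * volume (Metric.ball x ρ \ E) := by gcongr
    _ = ∫⁻ _ in Metric.ball x ρ \ E, ENNReal.ofReal (1 / ρ ^ ((N : ℝ) + α)) := by
        rw [setLIntegral_const]
    _ ≤ ∫⁻ y in Metric.ball x ρ \ E, kernel α (x - y) := by
        refine setLIntegral_mono' hm fun y hy => ENNReal.ofReal_le_ofReal ?_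
        have hxy : 0 < ‖x - y‖ := norm_pos_iff.2 (sub_ne_zero.2 fun h => hy.2 (h ▸ hx))
        have : ‖x - y‖ < ρ := by rw [← dist_eq_norm, dist_comm]; exact hy.1
        gcongr
    _ ≤ _ := lintegral_mono_set fun y hy => hy.2

/-! ### Test fields, divergence and the classical perimeter. -/

/-- The test fields in the definition of the perimeter. -/
structure IsTestField (φ : Euc N → Euc N) : Prop where
  contDiff : ContDiff ℝ 1 φ
  hasCompactSupport : HasCompactSupport φ
  norm_le : ∀ x, ‖φ x‖ ≤ 1

lemma perimeter_eq_biSup (E : Set (Euc N)) :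
    perimeter E = ⨆ φ ∈ {φ : Euc N → Euc N | IsTestField φ},
      ENNReal.ofReal (∫ x in E, divergence φ x) := by
  refine le_antisymm ?_ ?_
  · exact iSup_le fun φ => iSup_le fun h1 => iSup_le fun h2 => iSup_le fun h3 =>
      le_iSup₂_of_le φ ⟨h1, h2, h3⟩ le_rfl
  · exact iSup₂_le fun φ h => le_iSup_of_le φ <| le_iSup_of_le h.1 <| le_iSup_of_le h.2 <|
      le_iSup_of_le h.3 le_rfl

lemma IsTestField.le_perimeter {φ : Euc N → Euc N} (h : IsTestField φ) (E : Set (Euc N)) :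
    ENNReal.ofReal (∫ x in E, divergence φ x) ≤ perimeter E := by
  rw [perimeter_eq_biSup]; exact le_iSup₂_of_le φ h le_rfl

lemma perimeter_le {E : Set (Euc N)} {C : ℝ≥0∞}
    (h : ∀ φ : Euc N → Euc N, IsTestField φ → ENNReal.ofReal (∫ x in E, divergence φ x) ≤ C) :
    perimeter E ≤ C := by
  rw [perimeter_eq_biSup]; exact iSup₂_le h

lemma perimeter_congr {E E' : Set (Euc N)} (h : E =ᵐ[volume] E') :
    perimeter E = perimeter E' := by
  unfold perimeter
  rw [Measure.restrict_congr_set h]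

lemma isTestField_zero : IsTestField (0 : Euc N → Euc N) :=
  ⟨contDiff_const, HasCompactSupport.zero, by simp⟩

lemma divergence_zero : divergence (0 : Euc N → Euc N) = 0 := by
  ext x; simp [divergence]

lemma divergence_const_smul (c : ℝ) (φ : Euc N → Euc N) (x : Euc N) :
    divergence (c • φ) x = c * divergence φ x := by
  simp [divergence, fderiv_const_smul_field, Finset.mul_sum]

lemma divergence_eq_of_hasFDerivAt {φ : Euc N → Euc N} {φ' : Euc N →L[ℝ] Euc N} {x : Euc N}
    (h : HasFDerivAt φ φ' x) :
    divergence φ x = ∑ i : Fin N, (φ' (EuclideanSpace.single i 1)) i := by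
  rw [divergence, h.fderiv]

lemma sum_apply_single_mul (L : Euc N →L[ℝ] ℝ) (v : Euc N) :
    ∑ i : Fin N, L (EuclideanSpace.single i 1) * v i = L v := by
  have : v = ∑ i : Fin N, v i • EuclideanSpace.single i (1 : ℝ) := by
    ext j; simp [Pi.single_apply]
  conv_rhs => rw [this]
  simp [mul_comm]

lemma divergence_smul {η : Euc N → ℝ} {φ : Euc N → Euc N} {x : Euc N}
    (hη : DifferentiableAt ℝ η x) (hφ : DifferentiableAt ℝ φ x) :
    divergence (η • φ) x = η x * divergence φ x + fderiv ℝ η x (φ x) := by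
  rw [divergence_eq_of_hasFDerivAt (hη.hasFDerivAt.smul hφ.hasFDerivAt),
    ← sum_apply_single_mul (fderiv ℝ η x) (φ x), divergence, Finset.mul_sum,
    ← Finset.sum_add_distrib]
  simp

lemma divergence_add {φ ψ : Euc N → Euc N} {x : Euc N}
    (hφ : DifferentiableAt ℝ φ x) (hψ : DifferentiableAt ℝ ψ x) :
    divergence (φ + ψ) x = divergence φ x + divergence ψ x := by
  rw [divergence_eq_of_hasFDerivAt (hφ.hasFDerivAt.add hψ.hasFDerivAt), divergence, divergence,
    ← Finset.sum_add_distrib]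
  simp

lemma continuous_divergence {φ : Euc N → Euc N} (h : ContDiff ℝ 1 φ) :
    Continuous (divergence φ) := by
  have := h.continuous_fderiv one_ne_zero
  unfold divergence
  fun_prop

lemma hasCompactSupport_divergence {φ : Euc N → Euc N} (h : HasCompactSupport φ) :
    HasCompactSupport (divergence φ) := by
  refine (h.fderiv ℝ).mono fun x hx => ?_
  contrapose! hx
  simp only [Function.mem_support, ne_eq, not_not] at hx ⊢
  simp [divergence, hx]

lemma IsTestField.integrable_divergence {φ : Euc N → Euc N} (h : IsTestField φ) :
    Integrable (divergence φ) volume :=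
  (continuous_divergence h.1).integrable_of_hasCompactSupport (hasCompactSupport_divergence h.2)

/-- The divergence of a multiple of a test field integrates to at most the multiple of the
perimeter. -/
lemma ofReal_integral_divergence_le {φ : Euc N → Euc N} {M : ℝ} (h1 : ContDiff ℝ 1 φ)
    (h2 : HasCompactSupport φ) (hM : 0 < M) (h3 : ∀ x, ‖φ x‖ ≤ M) (E : Set (Euc N)) :
    ENNReal.ofReal (∫ x in E, divergence φ x) ≤ ENNReal.ofReal M * perimeter E := by
  have hφ : IsTestField (M⁻¹ • φ) := by
    refine ⟨contDiff_const.smul h1, h2.smul_left (f := fun _ => M⁻¹), fun x => ?_⟩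
    rw [Pi.smul_apply, norm_smul, norm_inv, Real.norm_of_nonneg hM.le, inv_mul_le_iff₀ hM, mul_one]
    exact h3 x
  have : ∫ x in E, divergence φ x = M * ∫ x in E, divergence (M⁻¹ • φ) x := by
    simp_rw [divergence_const_smul]
    rw [integral_const_mul, mul_inv_cancel_left₀ hM.ne']
  rw [this, ENNReal.ofReal_mul hM.le]
  gcongr
  exact hφ.le_perimeter E

lemma integral_divergence_le {φ : Euc N → Euc N} {M : ℝ} (h1 : ContDiff ℝ 1 φ)
    (h2 : HasCompactSupport φ) (hM : 0 < M) (h3 : ∀ x, ‖φ x‖ ≤ M) {E : Set (Euc N)}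
    (hE : perimeter E ≠ ∞) :
    ∫ x in E, divergence φ x ≤ M * (perimeter E).toReal := by
  have := ofReal_integral_divergence_le h1 h2 hM h3 E
  rw [← ENNReal.ofReal_toReal hE, ← ENNReal.ofReal_mul hM.le] at this
  exact (ENNReal.ofReal_le_ofReal_iff (by positivity)).1 this

/-- `ENNReal.ofReal` truncates negative integrals to 0, so a field with a negative integral may be
replaced by the zero field; the two suprema can then be tested with one signed sum. -/
lemma perimeter_add_le {A B : Set (Euc N)} {C : ℝ≥0∞}
    (h : ∀ φ ψ : Euc N → Euc N, IsTestField φ → IsTestField ψ →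
      ENNReal.ofReal ((∫ x in A, divergence φ x) + ∫ x in B, divergence ψ x) ≤ C) :
    perimeter A + perimeter B ≤ C := by
  rw [perimeter_eq_biSup, perimeter_eq_biSup]
  refine ENNReal.biSup_add_biSup_le ⟨0, isTestField_zero⟩ ⟨0, isTestField_zero⟩ ?_
  intro φ hφ ψ hψ
  rcases le_or_gt 0 (∫ x in A, divergence φ x) with h1 | h1
  · rcases le_or_gt 0 (∫ x in B, divergence ψ x) with h2 | h2
    · rw [← ENNReal.ofReal_add h1 h2]; exact h φ ψ hφ hψ
    · rw [ENNReal.ofReal_of_nonpos h2.le, add_zero]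
      simpa [divergence_zero] using h φ 0 hφ isTestField_zero
  · rw [ENNReal.ofReal_of_nonpos h1.le, zero_add]
    simpa [divergence_zero] using h 0 ψ isTestField_zero hψ

lemma perimeter_union_le {A B : Set (Euc N)} (hB : MeasurableSet B) (h : Disjoint A B) :
    perimeter (A ∪ B) ≤ perimeter A + perimeter B := by
  refine perimeter_le fun φ hφ => ?_
  have hi := hφ.integrable_divergence
  rw [setIntegral_union h hB hi.integrableOn hi.integrableOn]
  exact ENNReal.ofReal_add_le.trans (add_le_add (hφ.le_perimeter A) (hφ.le_perimeter B))

lemma perimeter_preimage_sub_le (E : Set (Euc N)) (h : Euc N) :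
    perimeter ((fun x => x - h) ⁻¹' E) ≤ perimeter E := by
  refine perimeter_le fun φ hφ => ?_
  have hφ' : IsTestField (fun y => φ (y + h)) := by
    refine ⟨hφ.1.comp (by fun_prop), ?_, fun x => hφ.3 _⟩
    exact hφ.2.comp_homeomorph (Homeomorph.addRight h)
  have : ∫ x in (fun x => x - h) ⁻¹' E, divergence φ x
      = ∫ x in E, divergence (fun y => φ (y + h)) x := by
    have hd : ∀ x, divergence (fun y => φ (y + h)) x = divergence φ (x + h) := by
      intro x; simp only [divergence]; rw [fderiv_comp_add_right]
    simp_rw [hd]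
    have := (measurePreserving_sub_right (volume : Measure (Euc N)) h).setIntegral_preimage_emb
      (MeasurableEquiv.subRight h).measurableEmbedding (fun x => divergence φ (x + h)) E
    simpa using this
  rw [this]
  exact hφ'.le_perimeter E

/-- A test field on the dilate l E pulls back to one on E: the change of variables contributes l^N
and the derivative l^(-1). -/
lemma perimeter_smul_le (E : Set (Euc N)) {l : ℝ} (hl : 0 < l) (hN : 1 ≤ N) :
    perimeter ((fun x : Euc N => l⁻¹ • x) ⁻¹' E) ≤ ENNReal.ofReal (l ^ (N - 1)) * perimeter E := by
  refine perimeter_le fun φ hφ => ?_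
  have hφ' : IsTestField (fun y => φ (l • y)) := by
    refine ⟨hφ.1.comp (by fun_prop), ?_, fun x => hφ.3 _⟩
    exact hφ.2.comp_homeomorph (Homeomorph.smulOfNeZero l hl.ne')
  have hd : ∀ x, divergence (fun y => φ (l • y)) x = l * divergence φ (l • x) := by
    intro x
    simp only [divergence]
    rw [fderiv_comp_smul]
    simp [Finset.mul_sum]
  have : ∫ x in (fun x : Euc N => l⁻¹ • x) ⁻¹' E, divergence φ x
      = l ^ (N - 1) * ∫ x in E, divergence (fun y => φ (l • y)) x := by
    simp_rw [hd]
    rw [integral_const_mul, ← mul_assoc, ← pow_succ, Nat.sub_add_cancel hN]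
    rw [Set.preimage_smul_inv₀ hl.ne']
    rw [Measure.setIntegral_comp_smul_of_pos _ _ _ hl]
    simp only [finrank_euclideanSpace, Fintype.card_fin, smul_eq_mul]
    rw [mul_inv_cancel_left₀ (by positivity)]
  rw [this, ENNReal.ofReal_mul (by positivity)]
  gcongr
  exact hφ'.le_perimeter E

lemma perimeter_univ : perimeter (Set.univ : Set (Euc N)) = 0 := by
  refine le_antisymm (perimeter_le fun φ hφ => ?_) zero_le
  rw [setIntegral_univ]
  have hi : ∀ i : Fin N, Integrable (fun x => (fderiv ℝ φ x (EuclideanSpace.single i 1)) i) := by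
    intro i
    have hc := hφ.1.continuous_fderiv one_ne_zero
    refine Continuous.integrable_of_hasCompactSupport (by fun_prop) ?_
    refine (hφ.2.fderiv ℝ).mono fun x hx => ?_
    contrapose! hx
    simp only [Function.mem_support, ne_eq, not_not] at hx ⊢
    simp [hx]
  have h0 : ∀ i : Fin N, ∫ x, (fderiv ℝ φ x (EuclideanSpace.single i 1)) i = 0 := by
    intro i
    have hd : ∀ x, (fderiv ℝ φ x (EuclideanSpace.single i 1)) i
        = fderiv ℝ (fun y => φ y i) x (EuclideanSpace.single i 1) := by
      intro x
      have h1 : HasFDerivAt φ (fderiv ℝ φ x) x :=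
        (hφ.1.differentiable one_ne_zero x).hasFDerivAt
      have h2 := ((EuclideanSpace.proj i : Euc N →L[ℝ] ℝ).hasFDerivAt (x := φ x)).comp x h1
      have h3 : (fun y => φ y i) = (EuclideanSpace.proj i : Euc N →L[ℝ] ℝ) ∘ φ := by ext; simp
      rw [h3, h2.fderiv]; simp
    have hs : Integrable (fun y => φ y i) := by
      have hc := hφ.1.continuous
      refine Continuous.integrable_of_hasCompactSupport (by fun_prop) ?_
      exact hφ.2.comp_left (g := fun v : Euc N => v i) (by simp)
    have hdiff : Differentiable ℝ (fun y => φ y i) := by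
      have := hφ.1.differentiable one_ne_zero
      fun_prop
    simp_rw [hd]
    have hii := hi i
    simp_rw [hd] at hii
    -- Integration by parts against the constant 1.
    have := integral_mul_fderiv_eq_neg_fderiv_mul_of_integrable (𝕜 := ℝ)
      (μ := (volume : Measure (Euc N))) (f := fun _ => (1 : ℝ)) (g := fun y => φ y i)
      (v := EuclideanSpace.single i 1) (by simp) (by simpa using hii) (by simpa using hs)
      (fun x _ => by fun_prop) (fun x _ => hdiff x)
    simpa using this
  unfold divergence
  rw [integral_finsetSum _ fun i _ => hi i]
  simp [h0]

/-! ### Translations, and control of the fractional perimeter by the classical one. -/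

lemma exists_contDiff_bump {K U : Set (Euc N)} (hK : IsCompact K) (hU : IsOpen U) (hKU : K ⊆ U) :
    ∃ ψ : Euc N → ℝ, ContDiff ℝ 1 ψ ∧ HasCompactSupport ψ ∧ (∀ x, ψ x ∈ Set.Icc (0 : ℝ) 1) ∧
      (∀ x ∈ K, ψ x = 1) ∧ ∀ x ∉ U, ψ x = 0 := by
  obtain ⟨V, hV, hKV, hVU, hVc⟩ := exists_open_between_and_isCompact_closure hK hU hKU
  obtain ⟨f, hf0, hf1, hf⟩ := exists_contMDiffMap_zero_one_of_isClosed (n := 1)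
    (modelWithCornersSelf ℝ (Euc N)) hV.isClosed_compl hK.isClosed
    (Set.disjoint_left.2 fun x hx hx' => hx (hKV hx'))
  refine ⟨f, f.contMDiff.contDiff, ?_, hf, fun x hx => hf1 hx,
    fun x hx => hf0 fun hxV => hx (hVU (subset_closure hxV))⟩
  refine HasCompactSupport.intro hVc fun x hx => hf0 fun hxV => hx (subset_closure hxV)

/-- The difference quotients of a scalar test function are controlled by the perimeter. -/
lemma integral_translate_sub_le {E : Set (Euc N)} (hE : volume E ≠ ∞) (hP : perimeter E ≠ ∞)
    {ψ : Euc N → ℝ} (h1 : ContDiff ℝ 1 ψ) (h2 : HasCompactSupport ψ) (h3 : ∀ x, |ψ x| ≤ 1)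
    {h : Euc N} (hh : h ≠ 0) :
    (∫ x in E, ψ (x + h)) - ∫ x in E, ψ x ≤ ‖h‖ * (perimeter E).toReal := by
  have : IsFiniteMeasure (volume.restrict E) := ⟨by simpa using hE.lt_top⟩
  have hc := h1.continuous_fderiv one_ne_zero
  have hψc := h1.continuous
  obtain ⟨C, hC⟩ := (h2.fderiv ℝ).exists_bound_of_continuous hc
  have hderiv : ∀ τ : ℝ, HasDerivAt (fun τ : ℝ => ∫ x in E, ψ (x + τ • h))
      (∫ x in E, fderiv ℝ ψ (x + τ • h) h) τ := by
    intro τ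
    refine (hasDerivAt_integral_of_dominated_loc_of_deriv_le (μ := volume.restrict E)
      (F := fun τ x => ψ (x + τ • h)) (F' := fun τ x => fderiv ℝ ψ (x + τ • h) h)
      (bound := fun _ => C * ‖h‖) Filter.univ_mem ?_ ?_ ?_ ?_ ?_ ?_).2
    · exact Filter.Eventually.of_forall fun τ =>
        Continuous.aestronglyMeasurable (by fun_prop)
    · exact Integrable.of_bound (C := 1) (Continuous.aestronglyMeasurable (by fun_prop))
        (Filter.Eventually.of_forall fun x => h3 _)
    · exact Continuous.aestronglyMeasurable (by fun_prop)
    · exact Filter.Eventually.of_forall fun x τ _ =>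
        (ContinuousLinearMap.le_opNorm _ _).trans (by gcongr; exact hC _)
    · exact integrable_const _
    · refine Filter.Eventually.of_forall fun x τ _ => ?_
      have ha : HasFDerivAt ψ (fderiv ℝ ψ (x + τ • h)) (x + τ • h) :=
        (h1.differentiable one_ne_zero _).hasFDerivAt
      have hb : HasDerivAt (fun τ : ℝ => x + τ • h) h τ := by
        simpa using ((hasDerivAt_id τ).smul_const h).const_add x
      exact ha.comp_hasDerivAt τ hb
  have hbound : ∀ τ : ℝ, ∫ x in E, fderiv ℝ ψ (x + τ • h) h ≤ ‖h‖ * (perimeter E).toReal := by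
    intro τ
    -- The derivative along h is the divergence of a field in the constant direction h, of norm at
    -- most |h|.
    have hdiv : ∀ x, divergence ((fun x => ψ (x + τ • h)) • fun _ => h) x
        = fderiv ℝ ψ (x + τ • h) h := by
      intro x
      rw [divergence_smul]
      · rw [fderiv_comp_add_right]
        simp [divergence]
      · exact ((h1.comp (g := ψ) (f := fun x => x + τ • h) (by fun_prop)).differentiable
          one_ne_zero) x
      · fun_prop
    simp_rw [← hdiv]
    refine integral_divergence_le ?_ ?_ (norm_pos_iff.2 hh) ?_ hP
    · exact (h1.comp (g := ψ) (f := fun x => x + τ • h) (by fun_prop)).smul contDiff_const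
    · exact (h2.comp_homeomorph (Homeomorph.addRight (τ • h))).smul_right
    · intro x
      simp only [Pi.smul_apply', norm_smul, Real.norm_eq_abs]
      exact mul_le_of_le_one_left (norm_nonneg _) (h3 _)
  have := image_sub_le_mul_sub_of_deriv_le (f := fun τ : ℝ => ∫ x in E, ψ (x + τ • h))
    (fun τ => (hderiv τ).differentiableAt) (fun τ => (hderiv τ).deriv ▸ hbound τ) zero_le_one
  simpa using this

/-- Translating a set by `h` moves a volume of at most `|h| P(E)` out of it. -/
lemma volume_preimage_sub_diff_le {E : Set (Euc N)} (hEm : MeasurableSet E) (hE : volume E ≠ ∞)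
    (h : Euc N) :
    volume ((fun x => x - h) ⁻¹' E \ E) ≤ ENNReal.ofReal ‖h‖ * perimeter E := by
  rcases eq_or_ne h 0 with rfl | hh
  · simp
  by_cases hP : perimeter E = ∞
  · rw [hP, ENNReal.mul_top (by simpa using hh)]; exact le_top
  have hm : MeasurableSet ((fun x : Euc N => x - h) ⁻¹' E) := by measurability
  rw [(hm.diff hEm).measure_eq_iSup_isCompact]
  refine iSup_le fun K => iSup_le fun hKD => iSup_le fun hK => ?_
  refine ENNReal.le_of_forall_pos_le_add fun ε hε _ => ?_
  -- The bump ψ is 1 on K and lives in U, so it approximates the indicator of a compact part K of (E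
  -- + h) \ E.
  obtain ⟨U, hKU, hU, hUK⟩ := K.exists_isOpen_lt_add (μ := volume) hK.measure_ne_top
    (ε := ε) (by simpa using hε.ne')
  obtain ⟨ψ, h1, h2, h3, h4, h5⟩ := exists_contDiff_bump hK hU hKU
  have hint : Integrable ψ volume := h1.continuous.integrable_of_hasCompactSupport h2
  have hmain := integral_translate_sub_le hE hP h1 h2
    (fun x => abs_le.2 ⟨by linarith [(h3 x).1], (h3 x).2⟩) hh
  have e1 : ∫ x in E, ψ (x + h) = ∫ x in (fun x => x - h) ⁻¹' E, ψ x := by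
    have := (measurePreserving_sub_right (volume : Measure (Euc N)) h).setIntegral_preimage_emb
      (MeasurableEquiv.subRight h).measurableEmbedding (fun x => ψ (x + h)) E
    simpa using this.symm
  have e2 : (volume K).toReal ≤ ∫ x in (fun x => x - h) ⁻¹' E, ψ x := by
    calc (volume K).toReal = ∫ x in K, (1 : ℝ) := by simp [Measure.real]
      _ = ∫ x in K, ψ x := setIntegral_congr_fun hK.measurableSet fun x hx => (h4 x hx).symm
      _ ≤ _ := setIntegral_mono_set hint.integrableOn
          (Filter.Eventually.of_forall fun x => (h3 x).1)
          (Filter.Eventually.of_forall fun x hx => (hKD hx).1)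
  have hUKm : MeasurableSet (U \ K) := hU.measurableSet.diff hK.measurableSet
  have hUKε : volume (U \ K) ≤ ε := by
    rw [measure_sdiff hKU hK.measurableSet.nullMeasurableSet hK.measure_ne_top]
    exact tsub_le_iff_left.2 hUK.le
  -- K misses E, so E only sees ψ on U \ K.
  have e3 : ∫ x in E, ψ x ≤ ε := by
    calc ∫ x in E, ψ x ≤ ∫ x in E, (U \ K).indicator 1 x := by
          refine setIntegral_mono_on hint.integrableOn ?_ hEm fun x hx => ?_
          · refine ((integrable_indicator_iff hUKm).2 ?_).integrableOn
            exact integrableOn_const (hUKε.trans_lt ENNReal.coe_lt_top).ne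
          · by_cases hxU : x ∈ U
            · rw [Set.indicator_of_mem (Set.mem_sdiff_of_mem hxU fun hxK => (hKD hxK).2 hx)]
              exact (h3 x).2
            · rw [h5 x hxU]
              exact Set.indicator_nonneg (fun _ _ => zero_le_one) _
      _ ≤ ∫ x, (U \ K).indicator 1 x := by
          refine setIntegral_le_integral ?_ ?_
          · refine ((integrable_indicator_iff hUKm).2 ?_)
            exact integrableOn_const (hUKε.trans_lt ENNReal.coe_lt_top).ne
          · exact Filter.Eventually.of_forall fun x =>
              Set.indicator_nonneg (fun _ _ => zero_le_one) _
      _ = (volume (U \ K)).toReal := by rw [integral_indicator_one hUKm]; rfl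
      _ ≤ ε := ENNReal.toReal_le_of_le_ofReal ε.2 (by simpa using hUKε)
  rw [e1] at hmain
  have : (volume K).toReal ≤ ‖h‖ * (perimeter E).toReal + ε := by linarith
  rw [← ENNReal.ofReal_toReal hK.measure_ne_top]
  refine (ENNReal.ofReal_le_ofReal this).trans ?_
  rw [ENNReal.ofReal_add (by positivity) ε.coe_nonneg, ENNReal.ofReal_mul (by positivity),
    ENNReal.ofReal_toReal hP, ENNReal.ofReal_coe_nnreal]

lemma volume_diff_preimage_sub_le {E : Set (Euc N)} (hEm : MeasurableSet E) (hE : volume E ≠ ∞)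
    (h : Euc N) :
    volume (E \ (fun x => x - h) ⁻¹' E) ≤ ENNReal.ofReal ‖h‖ * perimeter E := by
  -- E \ (E + h) is the translate by h of (E - h) \ E.
  have h1 := volume_preimage_sub_diff_le hEm hE (-h)
  have hm : MeasurableSet ((fun x : Euc N => x - -h) ⁻¹' E \ E) := by measurability
  have := (measurePreserving_sub_right (volume : Measure (Euc N)) h).measure_preimage
      hm.nullMeasurableSet
  rw [norm_neg, ← this] at h1
  refine le_of_eq_of_le ?_ h1
  congr 1
  ext x
  simp

/-- |E \ (E + z)| is at most |z| P(E) and at most |E|, hence at most min(|z|, 1) (P(E) + |E|). -/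
lemma fracPerimeter_le_of_perimeter (α : ℝ) {E : Set (Euc N)} (hEm : MeasurableSet E)
    (hE : volume E ≠ ∞) :
    fracPerimeter α E ≤ truncConst N α * (perimeter E + volume E) := by
  rw [fracPerimeter_eq_lintegral α hEm]
  unfold truncConst
  rw [← lintegral_mul_const _ (by fun_prop)]
  refine lintegral_mono fun z => ?_
  dsimp only
  rw [mul_comm (ENNReal.ofReal _), mul_assoc]
  gcongr
  rcases le_total ‖z‖ 1 with h | h
  · rw [min_eq_left h]
    exact (volume_diff_preimage_sub_le hEm hE z).trans (by gcongr; exact le_self_add)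
  · rw [min_eq_right h, ENNReal.ofReal_one, one_mul]
    exact (measure_mono Set.sdiff_subset).trans le_add_self

/-- With zero perimeter, E is invariant under all translations up to null sets. The preceding bound
would leave a term in |E|. -/
lemma fracPerimeter_eq_zero_of_perimeter (α : ℝ) {E : Set (Euc N)} (hEm : MeasurableSet E)
    (hE : volume E ≠ ∞) (hP : perimeter E = 0) : fracPerimeter α E = 0 := by
  rw [fracPerimeter_eq_lintegral α hEm]
  have : ∀ z : Euc N, volume (E \ (fun x => x - z) ⁻¹' E) = 0 := fun z => by
    have := volume_diff_preimage_sub_le hEm hE z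
    rwa [hP, mul_zero, nonpos_iff_eq_zero] at this
  simp [this]

/-! ### Radial cutoffs and the choice of a good radius. -/

open Filter Topology Metric

lemma exists_bound_deriv_smoothTransition :
    ∃ C : ℝ, 0 < C ∧ ∀ τ, |deriv Real.smoothTransition τ| ≤ C := by
  have hc : Continuous (deriv Real.smoothTransition) :=
    (Real.smoothTransition.contDiff (n := 1)).continuous_deriv le_rfl
  obtain ⟨C, hC⟩ := (isCompact_Icc (a := (0 : ℝ)) (b := 1)).exists_bound_of_continuousOn
    hc.continuousOn
  refine ⟨max C 1, by positivity, fun τ => ?_⟩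
  by_cases hτ : τ ∈ Set.Icc (0 : ℝ) 1
  · exact (hC τ hτ).trans (le_max_left _ _)
  · have : deriv Real.smoothTransition τ = 0 := by
      rw [Set.mem_Icc, not_and_or, not_le, not_le] at hτ
      rcases hτ with h | h
      · exact IsLocalMin.deriv_eq_zero <| Filter.Eventually.of_forall fun y => by
          rw [Real.smoothTransition.zero_of_nonpos h.le]; exact Real.smoothTransition.nonneg y
      · exact IsLocalMax.deriv_eq_zero <| Filter.Eventually.of_forall fun y => by
          rw [Real.smoothTransition.one_of_one_le h.le]; exact Real.smoothTransition.le_one y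
    rw [this, abs_zero]; positivity

/-- A smooth cutoff which is `1` on the ball of radius `r` and `0` off that of radius `r + ε`. -/
def cutoff (r ε : ℝ) (x : Euc N) : ℝ :=
  Real.smoothTransition (((r + ε) ^ 2 - ‖x‖ ^ 2) / ((r + ε) ^ 2 - r ^ 2))

lemma cutoff_mem_Icc (r ε : ℝ) (x : Euc N) : cutoff r ε x ∈ Set.Icc (0 : ℝ) 1 :=
  ⟨Real.smoothTransition.nonneg _, Real.smoothTransition.le_one _⟩

lemma contDiff_cutoff (r ε : ℝ) : ContDiff ℝ 1 (cutoff r ε : Euc N → ℝ) :=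
  Real.smoothTransition.contDiff.comp
    ((contDiff_const.sub (contDiff_norm_sq ℝ)).div_const _)

lemma cutoff_eq_one {r ε : ℝ} (hr : 0 < r) (hε : 0 < ε) {x : Euc N} (hx : ‖x‖ ≤ r) :
    cutoff r ε x = 1 := by
  refine Real.smoothTransition.one_of_one_le ?_
  rw [one_le_div (by nlinarith)]
  gcongr

lemma cutoff_eq_zero {r ε : ℝ} (hr : 0 < r) (hε : 0 < ε) {x : Euc N} (hx : r + ε ≤ ‖x‖) :
    cutoff r ε x = 0 := by
  refine Real.smoothTransition.zero_of_nonpos ?_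
  refine div_nonpos_of_nonpos_of_nonneg ?_ (by nlinarith)
  rw [sub_nonpos]
  gcongr

/-- Where the cutoff takes its extreme values 1 and 0 its derivative vanishes, on the two bounding
spheres as well. -/
lemma fderiv_cutoff_eq_zero {r ε : ℝ} (hr : 0 < r) (hε : 0 < ε) {x : Euc N}
    (hx : x ∉ closedBall (0 : Euc N) (r + ε) \ closedBall 0 r) : fderiv ℝ (cutoff r ε) x = 0 := by
  have : ‖x‖ ≤ r ∨ r + ε ≤ ‖x‖ := by
    by_contra! h
    exact hx ⟨by simpa using h.2.le, by simpa using h.1⟩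
  rcases this with h | h
  · exact IsLocalMax.fderiv_eq_zero <| Filter.Eventually.of_forall fun y => by
      rw [cutoff_eq_one hr hε h]; exact (cutoff_mem_Icc _ _ _).2
  · exact IsLocalMin.fderiv_eq_zero <| Filter.Eventually.of_forall fun y => by
      rw [cutoff_eq_zero hr hε h]; exact (cutoff_mem_Icc _ _ _).1

/-- On the shell the argument of the transition has gradient of norm 2|x| / (ε(2r + ε)) ≤ 2/ε. -/
lemma norm_fderiv_cutoff_le {C : ℝ} (hC : ∀ τ, |deriv Real.smoothTransition τ| ≤ C) {r ε : ℝ}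
    (hr : 0 < r) (hε : 0 < ε) (x : Euc N) : ‖fderiv ℝ (cutoff r ε) x‖ ≤ 2 * C / ε := by
  have hC0 : 0 ≤ C := (abs_nonneg _).trans (hC 0)
  by_cases hx : x ∈ closedBall (0 : Euc N) (r + ε) \ closedBall 0 r
  swap
  · rw [fderiv_cutoff_eq_zero hr hε hx, norm_zero]; positivity
  have hx' : ‖x‖ ≤ r + ε := by simpa using hx.1
  have hD : (r + ε) ^ 2 - r ^ 2 = ε * (2 * r + ε) := by ring
  have h1 : HasFDerivAt (fun x : Euc N => ((r + ε) ^ 2 - ‖x‖ ^ 2) / ((r + ε) ^ 2 - r ^ 2))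
      (((r + ε) ^ 2 - r ^ 2)⁻¹ • -((2 : ℝ) • innerSL ℝ x)) x := by
    simp_rw [div_eq_inv_mul]
    have := (hasStrictFDerivAt_norm_sq x).hasFDerivAt
    rw [← Nat.cast_smul_eq_nsmul ℝ] at this
    exact (this.const_sub _).const_mul _
  have h2 := ((Real.smoothTransition.contDiff (n := 1)).differentiable one_ne_zero
    (((r + ε) ^ 2 - ‖x‖ ^ 2) / ((r + ε) ^ 2 - r ^ 2))).hasDerivAt.comp_hasFDerivAt x h1
  have h3 : fderiv ℝ (cutoff r ε) x = _ := h2.fderiv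
  rw [h3, norm_smul, norm_smul, norm_neg, hD, Real.norm_eq_abs]
  have h4 : ‖(2 : ℝ) • innerSL ℝ x‖ ≤ 2 * (r + ε) := by
    rw [norm_smul, innerSL_apply_norm]
    simpa using hx'
  have hpos : 0 < ε * (2 * r + ε) := by positivity
  calc _ ≤ C * ((ε * (2 * r + ε))⁻¹ * (2 * (r + ε))) := by
        rw [Real.norm_of_nonneg (inv_nonneg.2 hpos.le)]
        gcongr
        exact hC _
    _ ≤ 2 * C / ε := by
        rw [inv_mul_eq_div, mul_div_assoc', div_le_div_iff₀ hpos hε]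
        nlinarith [mul_nonneg (mul_nonneg hC0 hε.le) hr.le, mul_nonneg hC0 (sq_nonneg ε)]

/-- Cutting a set along a sphere increases the perimeter at most by a multiple of the rate at
which the volume grows across that sphere. -/
lemma exists_perimeter_inter_add_diff_le : ∃ C : ℝ, 0 < C ∧ ∀ {N : ℕ} {F : Set (Euc N)},
    MeasurableSet F → ∀ {r K : ℝ}, 0 < r → 0 ≤ K →
    (∀ᶠ ε in 𝓝[>] (0 : ℝ), volume (F ∩ (closedBall 0 (r + ε) \ closedBall 0 r)) ≤
      ENNReal.ofReal (K * ε)) →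
    perimeter (F ∩ closedBall 0 r) + perimeter (F \ closedBall 0 r) ≤
      perimeter F + ENNReal.ofReal (C * K) := by
  obtain ⟨C, hC0, hC⟩ := exists_bound_deriv_smoothTransition
  refine ⟨4 * C, by positivity, ?_⟩
  intro N F hF r K hr hK hshell
  by_cases hP : perimeter F = ∞
  · rw [hP, top_add]; exact le_top
  refine perimeter_add_le fun φ ψ hφ hψ => ?_
  rw [← ENNReal.ofReal_toReal hP, ← ENNReal.ofReal_add (by positivity) (by positivity)]
  refine ENNReal.ofReal_le_ofReal ?_
  have hdφ := hφ.integrable_divergence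
  have hdψ := hψ.integrable_divergence
  have hcφ := continuous_divergence hφ.1
  have hcψ := continuous_divergence hψ.1
  have hB : MeasurableSet (closedBall (0 : Euc N) r) := measurableSet_closedBall
  set a : ℝ → ℝ := fun ε => ∫ x in F,
    (cutoff r ε x * divergence φ x + (1 - cutoff r ε x) * divergence ψ x) with ha
  have hint : ∀ ε, Integrable
      (fun x => cutoff r ε x * divergence φ x + (1 - cutoff r ε x) * divergence ψ x) := by
    intro ε
    have hcc := (contDiff_cutoff (N := N) r ε).continuous
    refine (hdφ.bdd_mul (c := 1) hcc.aestronglyMeasurable (Eventually.of_forall fun x => ?_)).add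
      (hdψ.bdd_mul (c := 1) (Continuous.aestronglyMeasurable (by fun_prop))
        (Eventually.of_forall fun x => ?_))
    · rw [Real.norm_of_nonneg (cutoff_mem_Icc _ _ _).1]; exact (cutoff_mem_Icc _ _ _).2
    · rw [Real.norm_of_nonneg (by linarith [(cutoff_mem_Icc r ε x).2])]
      linarith [(cutoff_mem_Icc r ε x).1]
  have hlim : Tendsto a (𝓝[>] 0) (𝓝 ((∫ x in F ∩ closedBall 0 r, divergence φ x) +
      ∫ x in F \ closedBall 0 r, divergence ψ x)) := by
    have e : (∫ x in F ∩ closedBall 0 r, divergence φ x) +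
        ∫ x in F \ closedBall 0 r, divergence ψ x =
        ∫ x in F, ((closedBall 0 r).indicator (divergence φ) x +
          (closedBall 0 r)ᶜ.indicator (divergence ψ) x) := by
      rw [integral_add (hdφ.indicator hB).integrableOn (hdψ.indicator hB.compl).integrableOn,
        setIntegral_indicator hB, setIntegral_indicator hB.compl]
      rfl
    rw [e]
    refine tendsto_integral_filter_of_dominated_convergence
      (fun x => ‖divergence φ x‖ + ‖divergence ψ x‖) ?_ ?_ ?_ ?_
    · exact Eventually.of_forall fun ε => (hint ε).aestronglyMeasurable.restrict
    · refine Eventually.of_forall fun ε => Eventually.of_forall fun x => ?_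
      have := cutoff_mem_Icc r ε x
      refine (norm_add_le _ _).trans ?_
      rw [norm_mul, norm_mul, Real.norm_of_nonneg this.1,
        Real.norm_of_nonneg (by linarith [this.2] : 0 ≤ 1 - cutoff r ε x)]
      refine add_le_add (mul_le_of_le_one_left (norm_nonneg _) this.2)
        (mul_le_of_le_one_left (norm_nonneg _) (by linarith [this.1]))
    · exact (hdφ.norm.add hdψ.norm).integrableOn
    · refine Eventually.of_forall fun x => ?_
      -- For a fixed x the integrand is constant once ε is small, equal to its limit.
      refine tendsto_const_nhds.congr' ?_
      rcases le_or_gt ‖x‖ r with h | h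
      · filter_upwards [self_mem_nhdsWithin] with ε hε
        have h' : x ∈ closedBall (0 : Euc N) r := by simpa using h
        rw [cutoff_eq_one hr hε h, Set.indicator_of_mem h',
          Set.indicator_of_notMem (by simpa using h)]
        ring
      · have : Set.Ioo (0 : ℝ) (‖x‖ - r) ∈ 𝓝[>] (0 : ℝ) :=
          Ioo_mem_nhdsGT (by linarith)
        filter_upwards [this] with ε hε
        have h' : x ∉ closedBall (0 : Euc N) r := by simpa using h
        rw [cutoff_eq_zero hr hε.1 (by linarith [hε.2]), Set.indicator_of_notMem h',
          Set.indicator_of_mem (by exact h')]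
        ring
  refine le_of_tendsto hlim ?_
  filter_upwards [hshell, self_mem_nhdsWithin] with ε hε hε0
  have hε0 : 0 < ε := hε0
  set η : Euc N → ℝ := cutoff r ε with hη
  have hηc : ContDiff ℝ 1 η := contDiff_cutoff r ε
  have hηd := hηc.differentiable one_ne_zero
  have hφd := hφ.1.differentiable one_ne_zero
  have hψd := hψ.1.differentiable one_ne_zero
  -- A pointwise convex combination of test fields is a test field. Gluing them costs the term ∇η ·
  -- (φ - ψ), of size at most (2C/ε) · 2 on a set of measure at most Kε, which gives 4CK.
  set X : Euc N → Euc N := η • φ + (fun x => 1 - η x) • ψ with hX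
  have hXt : IsTestField X := by
    refine ⟨(hηc.smul hφ.1).add ((contDiff_const.sub hηc).smul hψ.1),
      (hφ.2.smul_left (f := η)).add (hψ.2.smul_left (f := fun x => 1 - η x)), fun x => ?_⟩
    have := cutoff_mem_Icc r ε x
    have h1 := hφ.3 x
    have h2 := hψ.3 x
    calc ‖X x‖ ≤ ‖η x • φ x‖ + ‖(1 - η x) • ψ x‖ := norm_add_le _ _
      _ = η x * ‖φ x‖ + (1 - η x) * ‖ψ x‖ := by
          rw [norm_smul, norm_smul, Real.norm_of_nonneg this.1,
            Real.norm_of_nonneg (by linarith [this.2] : 0 ≤ 1 - η x)]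
      _ ≤ 1 := by nlinarith [this.1, this.2]
  have hdiv : ∀ x, divergence X x = (η x * divergence φ x + (1 - η x) * divergence ψ x)
      + fderiv ℝ η x (φ x - ψ x) := by
    intro x
    have hη1 : DifferentiableAt ℝ (fun x => 1 - η x) x := by fun_prop
    rw [hX, divergence_add ((hηd x).smul (hφd x)) (hη1.smul (hψd x)),
      divergence_smul (hηd x) (hφd x), divergence_smul hη1 (hψd x)]
    rw [fderiv_const_sub]
    simp only [neg_apply, map_sub]
    ring
  have hXi := hXt.integrable_divergence
  have hgi : Integrable (fun x => fderiv ℝ η x (φ x - ψ x)) := by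
    have : (fun x => fderiv ℝ η x (φ x - ψ x)) = fun x => divergence X x -
        (η x * divergence φ x + (1 - η x) * divergence ψ x) := by
      ext x; rw [hdiv]; ring
    rw [this]
    exact hXi.sub (hint ε)
  have hsplit : a ε = (∫ x in F, divergence X x) - ∫ x in F, fderiv ℝ η x (φ x - ψ x) := by
    rw [← integral_sub hXi.integrableOn hgi.integrableOn]
    refine integral_congr_ae (Eventually.of_forall fun x => ?_)
    simp only [hdiv]; ring
  have hXle : ∫ x in F, divergence X x ≤ (perimeter F).toReal := by
    simpa using integral_divergence_le hXt.1 hXt.2 one_pos hXt.3 hP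
  set S : Set (Euc N) := closedBall 0 (r + ε) \ closedBall 0 r with hS
  have hgS : ‖∫ x in F, fderiv ℝ η x (φ x - ψ x)‖ ≤ 4 * C * K := by
    have : ∫ x in F, fderiv ℝ η x (φ x - ψ x) = ∫ x in F ∩ S, fderiv ℝ η x (φ x - ψ x) := by
      refine (setIntegral_eq_of_subset_of_forall_sdiff_eq_zero hF Set.inter_subset_left ?_)
      intro x hx
      rw [fderiv_cutoff_eq_zero hr hε0 fun h => hx.2 ⟨hx.1, h⟩]; rfl
    rw [this]
    have hfin : volume (F ∩ S) < ∞ := hε.trans_lt ENNReal.ofReal_lt_top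
    refine (norm_setIntegral_le_of_norm_le_const (C := 2 * C / ε * 2) hfin fun x _ => ?_).trans ?_
    · refine (ContinuousLinearMap.le_opNorm _ _).trans ?_
      have h1 : ‖φ x - ψ x‖ ≤ 2 := by
        linarith [norm_sub_le (φ x) (ψ x), hφ.3 x, hψ.3 x]
      exact mul_le_mul (norm_fderiv_cutoff_le hC hr hε0 x) h1 (norm_nonneg _) (by positivity)
    · have : volume.real (F ∩ S) ≤ K * ε := ENNReal.toReal_le_of_le_ofReal (by positivity) hε
      calc _ ≤ 2 * C / ε * 2 * (K * ε) := by gcongr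
        _ = 4 * C * K := by field_simp; ring
  have := abs_le.1 hgS
  rw [hsplit]
  linarith [this.1]

lemma volume_inter_closedBall_ne_top (F : Set (Euc N)) (r : ℝ) :
    volume (F ∩ closedBall 0 r) ≠ ∞ :=
  ((measure_mono Set.inter_subset_right).trans_lt measure_closedBall_lt_top).ne

/-- In any interval of radii there is one at which the volume grows at most at the mean rate. -/
lemma exists_radius {F : Set (Euc N)} (hF : MeasurableSet F) {ρ d K : ℝ} (hd : 0 < d)
    (hK : volume.real (F ∩ closedBall 0 (ρ + d)) - volume.real (F ∩ closedBall 0 ρ) < K * d) :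
    ∃ r ∈ Set.Icc ρ (ρ + d), ∀ᶠ ε in 𝓝[>] (0 : ℝ),
      volume (F ∩ (closedBall 0 (r + ε) \ closedBall 0 r)) ≤ ENNReal.ofReal (K * ε) := by
  set f : ℝ → ℝ := fun r => volume.real (F ∩ closedBall 0 r) with hf
  have hmono : Monotone f := fun a b hab =>
    measureReal_mono (by gcongr) (volume_inter_closedBall_ne_top F b)
  have hab : ρ ≤ ρ + d := by linarith
  have hmonoOn : MonotoneOn f (Set.uIcc ρ (ρ + d)) := hmono.monotoneOn _
  -- The derivative of a monotone function integrates to at most its increment; absolute continuity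
  -- is not needed.
  have hint := (hmonoOn.intervalIntegral_deriv_mem_uIcc)
  rw [Set.uIcc_of_le (sub_nonneg.2 (hmono hab))] at hint
  obtain ⟨r, hr, hdiff, hlt⟩ : ∃ r ∈ Set.Icc ρ (ρ + d), DifferentiableAt ℝ f r ∧ deriv f r < K := by
    by_contra! hcon
    have : K * d ≤ ∫ x in ρ..(ρ + d), deriv f x := by
      calc K * d = ∫ x in ρ..(ρ + d), K := by simp; ring
        _ ≤ _ := by
          refine intervalIntegral.integral_mono_ae_restrict hab (by simp)
            hmonoOn.intervalIntegrable_deriv ?_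
          filter_upwards [ae_restrict_of_ae hmono.ae_differentiableAt,
            ae_restrict_mem measurableSet_Icc] with x hx hx'
          exact hcon x hx' hx
    linarith [hint.2]
  refine ⟨r, hr, ?_⟩
  have hs := hasDerivAt_iff_tendsto_slope_zero.1 hdiff.hasDerivAt
  have hs' := hs.mono_left (nhdsWithin_mono (0 : ℝ) fun x (hx : 0 < x) => hx.ne')
  filter_upwards [hs'.eventually (gt_mem_nhds hlt), self_mem_nhdsWithin] with ε h1 h0
  have h0 : 0 < ε := h0
  rw [smul_eq_mul, inv_mul_lt_iff₀ h0] at h1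
  have hm : MeasurableSet (F ∩ closedBall 0 r) := hF.inter measurableSet_closedBall
  have hset : F ∩ (closedBall 0 (r + ε) \ closedBall 0 r)
      = (F ∩ closedBall 0 (r + ε)) \ (F ∩ closedBall 0 r) := by
    ext x; simp only [Set.mem_inter_iff, Set.mem_sdiff]; tauto
  have hsub : F ∩ closedBall 0 r ⊆ F ∩ closedBall 0 (r + ε) := by gcongr; linarith
  rw [hset, measure_sdiff hsub hm.nullMeasurableSet (volume_inter_closedBall_ne_top F r),
    ← ENNReal.ofReal_toReal (volume_inter_closedBall_ne_top F r),
    ← ENNReal.ofReal_toReal (volume_inter_closedBall_ne_top F (r + ε)),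
    ← ENNReal.ofReal_sub _ ENNReal.toReal_nonneg]
  refine ENNReal.ofReal_le_ofReal ?_
  rw [mul_comm]
  exact h1.le

/-- In any interval of radii there is one at which the two parts interact little. -/
lemma exists_interaction_cut_le (α : ℝ) {F : Set (Euc N)} (hF : MeasurableSet F) (ρ : ℝ) {d : ℝ}
    (hd : 0 < d) (hd1 : d ≤ 1) :
    ∃ r ∈ Set.Icc ρ (ρ + d), interaction α (F ∩ closedBall 0 r) (F \ closedBall 0 r) ≤
      truncConst N α * volume (F \ closedBall 0 ρ) / ENNReal.ofReal d := by
  -- The pair (x, y) interacts across the sphere of radius r when |y| ≤ r < |x|. Such radii have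
  -- measure at most |x - y|, and at most d ≤ 1 within the interval, so integrating in r turns the
  -- kernel into the integrand of `truncConst`.
  set g : ℝ → Euc N → Euc N → ℝ≥0∞ := fun r x y =>
    (Set.Ico ‖y‖ ‖x‖).indicator (fun _ => kernel α (x - y)) r with hg
  have hgm : Measurable (fun p : (ℝ × Euc N) × Euc N => g p.1.1 p.1.2 p.2) := by
    have hs : MeasurableSet {p : (ℝ × Euc N) × Euc N | ‖p.2‖ ≤ p.1.1 ∧ p.1.1 < ‖p.1.2‖} :=
      (measurableSet_le (measurable_snd.norm) (measurable_fst.comp measurable_fst)).inter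
        (measurableSet_lt (measurable_fst.comp measurable_fst)
          (measurable_snd.comp measurable_fst).norm)
    exact Measurable.indicator (f := fun p : (ℝ × Euc N) × Euc N => kernel α (p.1.2 - p.2))
      (by fun_prop) hs
  have hGm : Measurable (fun p : ℝ × Euc N => ∫⁻ y, g p.1 p.2 y) := hgm.lintegral_prod_right'
  have hHm : Measurable (fun r : ℝ => ∫⁻ x in F \ closedBall 0 ρ, ∫⁻ y, g r x y) :=
    hGm.lintegral_prod_right'
  have hle : ∀ r ∈ Set.Icc ρ (ρ + d), interaction α (F ∩ closedBall 0 r) (F \ closedBall 0 r) ≤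
      ∫⁻ x in F \ closedBall 0 ρ, ∫⁻ y, g r x y := by
    intro r hr
    rw [interaction_comm]
    unfold interaction
    have hsub : F \ closedBall (0 : Euc N) r ⊆ F \ closedBall 0 ρ := by
      gcongr; exact hr.1
    refine (setLIntegral_mono' (hF.diff measurableSet_closedBall) fun x hx => ?_).trans
      (lintegral_mono_set hsub)
    refine (setLIntegral_mono' (hF.inter measurableSet_closedBall) fun y hy => ?_).trans
      (setLIntegral_le_lintegral _ _)
    have h1 : ‖y‖ ≤ r := by simpa using hy.2
    have h2 : r < ‖x‖ := by simpa using hx.2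
    rw [hg]
    simp only
    rw [Set.indicator_of_mem (Set.mem_Ico.2 ⟨h1, h2⟩)]
  have hgr : ∀ x y, ∫⁻ r in Set.Icc ρ (ρ + d), g r x y ≤
      ENNReal.ofReal (min ‖x - y‖ 1) * kernel α (x - y) := by
    intro x y
    rw [hg]
    simp only
    rw [lintegral_indicator measurableSet_Ico, setLIntegral_const, mul_comm,
      Measure.restrict_apply measurableSet_Ico]
    gcongr
    rw [ENNReal.ofReal_min]
    refine le_min ?_ ?_
    · refine (measure_mono Set.inter_subset_left).trans ?_
      rw [Real.volume_Ico]
      exact ENNReal.ofReal_le_ofReal (norm_sub_norm_le x y)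
    · refine (measure_mono Set.inter_subset_right).trans ?_
      rw [Real.volume_Icc]
      exact ENNReal.ofReal_le_ofReal (by linarith)
  have htot : ∫⁻ r in Set.Icc ρ (ρ + d), ∫⁻ x in F \ closedBall 0 ρ, ∫⁻ y, g r x y ≤
      truncConst N α * volume (F \ closedBall 0 ρ) := by
    rw [lintegral_lintegral_swap hGm.aemeasurable, ← setLIntegral_const]
    refine lintegral_mono fun x => ?_
    have hgx : Measurable (fun p : ℝ × Euc N => g p.1 x p.2) :=
      hgm.comp (g := fun p : (ℝ × Euc N) × Euc N => g p.1.1 p.1.2 p.2)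
        (f := fun p : ℝ × Euc N => ((p.1, x), p.2)) (by fun_prop)
    rw [lintegral_lintegral_swap hgx.aemeasurable]
    refine (lintegral_mono fun y => hgr x y).trans_eq ?_
    exact lintegral_sub_left_eq_self (μ := (volume : Measure (Euc N)))
      (fun z => ENNReal.ofReal (min ‖z‖ 1) * kernel α z) x
  have hvol : volume (Set.Icc ρ (ρ + d)) = ENNReal.ofReal d := by rw [Real.volume_Icc]; simp
  obtain ⟨r, hr, hr'⟩ := exists_le_setLAverage (μ := volume) (s := Set.Icc ρ (ρ + d))
    (by rw [hvol]; simpa using hd) (by rw [hvol]; simp) hHm.aemeasurable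
  refine ⟨r, hr, (hle r hr).trans (hr'.trans ?_)⟩
  rw [setLAverage_eq, hvol]
  gcongr

/-! ### Elementary properties of the two energy terms. -/

lemma two_mul_ofReal (x : ℝ) : 2 * ENNReal.ofReal x = ENNReal.ofReal (2 * x) := by
  rw [ENNReal.ofReal_mul zero_le_two, ENNReal.ofReal_ofNat]

lemma sphereConst_ne_zero (hN : 1 ≤ N) : sphereConst N ≠ 0 := by
  have : (N : ℝ≥0∞) ≠ 0 := by exact_mod_cast (by omega : N ≠ 0)
  exact mul_ne_zero this (measure_ball_pos _ _ one_pos).ne'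

lemma sphereConst_ne_top : sphereConst N ≠ ∞ :=
  ENNReal.mul_ne_top (ENNReal.natCast_ne_top N) measure_ball_lt_top.ne

lemma attractive_one (E : Set (Euc N)) : attractive 1 E = sphereConst N * perimeter E := by
  simp [attractive]

lemma attractive_of_lt {t : ℝ} (ht : t < 1) (E : Set (Euc N)) :
    attractive t E = ENNReal.ofReal (1 - t) * fracPerimeter t E := by
  simp [attractive, ht.ne]

lemma repulsive_zero (E : Set (Euc N)) : repulsive 0 E = sphereConst N * volume E := by
  simp [repulsive]

lemma repulsive_of_pos {s : ℝ} (hs : 0 < s) (E : Set (Euc N)) :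
    repulsive s E = ENNReal.ofReal s * fracPerimeter s E := by
  simp [repulsive, hs.ne']

lemma attractive_congr (t : ℝ) {E E' : Set (Euc N)} (h : E =ᵐ[volume] E') :
    attractive t E = attractive t E' := by
  simp only [attractive, perimeter_congr h, fracPerimeter_congr t h]

lemma repulsive_congr (s : ℝ) {E E' : Set (Euc N)} (h : E =ᵐ[volume] E') :
    repulsive s E = repulsive s E' := by
  simp only [repulsive, measure_congr h, fracPerimeter_congr s h]

lemma repulsive_union_le {s : ℝ} (hs : 0 ≤ s) {A B : Set (Euc N)} (hA : MeasurableSet A)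
    (hB : MeasurableSet B) (h : Disjoint A B) :
    repulsive s (A ∪ B) ≤ repulsive s A + repulsive s B := by
  rcases hs.eq_or_lt with rfl | hs
  · simp only [repulsive_zero, ← mul_add]
    gcongr
    exact measure_union_le A B
  · simp only [repulsive_of_pos hs, ← mul_add]
    gcongr
    exact fracPerimeter_union_le s hA hB h

/-! ### Scaling -/

lemma setLIntegral_preimage_smul {l : ℝ} (hl : 0 < l) {A : Set (Euc N)} (hA : MeasurableSet A)
    {f : Euc N → ℝ≥0∞} (hf : Measurable f) :
    ∫⁻ x in (fun x : Euc N => l⁻¹ • x) ⁻¹' A, f x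
      = ENNReal.ofReal (l ^ N) * ∫⁻ x in A, f (l • x) := by
  have hs : MeasurableSet ((fun x : Euc N => l⁻¹ • x) ⁻¹' A) := by measurability
  have h := setLIntegral_map (μ := (volume : Measure (Euc N))) (g := fun x => l • x) hs hf
    (by fun_prop)
  have hpre : (fun x : Euc N => l • x) ⁻¹' ((fun x : Euc N => l⁻¹ • x) ⁻¹' A) = A := by
    ext x; simp [hl.ne']
  rw [hpre, Measure.map_addHaar_smul _ hl.ne', Measure.restrict_smul, lintegral_smul_measure] at h
  rw [← h, finrank_euclideanSpace, Fintype.card_fin, abs_of_pos (by positivity), smul_eq_mul,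
    ← mul_assoc, ← ENNReal.ofReal_mul (by positivity), mul_inv_cancel₀ (by positivity),
    ENNReal.ofReal_one, one_mul]

lemma volume_preimage_smul {l : ℝ} (hl : 0 < l) (A : Set (Euc N)) :
    volume ((fun x : Euc N => l⁻¹ • x) ⁻¹' A) = ENNReal.ofReal (l ^ N) * volume A := by
  rw [Measure.addHaar_preimage_smul _ (inv_ne_zero hl.ne'), finrank_euclideanSpace,
    Fintype.card_fin, inv_pow, inv_inv, abs_of_pos (by positivity)]

lemma kernel_smul (α : ℝ) {l : ℝ} (hl : 0 < l) (z : Euc N) :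
    kernel α (l • z) = ENNReal.ofReal (l ^ (-((N : ℝ) + α))) * kernel α z := by
  unfold kernel
  rw [← ENNReal.ofReal_mul (by positivity), norm_smul, Real.norm_of_nonneg hl.le,
    Real.mul_rpow hl.le (norm_nonneg z), Real.rpow_neg hl.le, one_div, one_div, mul_inv]

lemma fracPerimeter_smul (α : ℝ) {l : ℝ} (hl : 0 < l) {E : Set (Euc N)} (hE : MeasurableSet E) :
    fracPerimeter α ((fun x : Euc N => l⁻¹ • x) ⁻¹' E)
      = ENNReal.ofReal (l ^ ((N : ℝ) - α)) * fracPerimeter α E := by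
  rw [fracPerimeter_eq_interaction, fracPerimeter_eq_interaction, ← Set.preimage_compl]
  unfold interaction
  have h1 : ∀ x : Euc N, ∫⁻ y in (fun x : Euc N => l⁻¹ • x) ⁻¹' Eᶜ, kernel α (x - y)
      = ENNReal.ofReal (l ^ N) * ∫⁻ y in Eᶜ, kernel α (x - l • y) := fun x =>
    setLIntegral_preimage_smul hl hE.compl (by fun_prop)
  have hm : Measurable fun x : Euc N => ∫⁻ y in Eᶜ, kernel α (x - l • y) :=
    Measurable.lintegral_prod_right' (f := fun p : Euc N × Euc N => kernel α (p.1 - l • p.2))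
      (by fun_prop)
  simp_rw [h1]
  rw [lintegral_const_mul _ hm, setLIntegral_preimage_smul hl hE hm]
  simp_rw [← smul_sub, kernel_smul α hl]
  have h2 : ∀ x : Euc N, ∫⁻ y in Eᶜ, ENNReal.ofReal (l ^ (-((N : ℝ) + α))) * kernel α (x - y)
      = ENNReal.ofReal (l ^ (-((N : ℝ) + α))) * ∫⁻ y in Eᶜ, kernel α (x - y) := fun x =>
    lintegral_const_mul' _ _ ENNReal.ofReal_ne_top
  simp_rw [h2]
  rw [lintegral_const_mul' _ _ ENNReal.ofReal_ne_top, ← mul_assoc, ← mul_assoc,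
    ← ENNReal.ofReal_mul (by positivity), ← ENNReal.ofReal_mul (by positivity)]
  congr 2
  rw [← Real.rpow_natCast, ← Real.rpow_add hl, ← Real.rpow_add hl]
  congr 1; ring

/-- The homogeneity degree is N - t, replaced by the cruder N so that the factor is the ratio of the
volumes. -/
lemma attractive_smul_le {t : ℝ} (ht0 : 0 ≤ t) (ht : t ≤ 1) (hN : 1 ≤ N) {l : ℝ} (hl : 1 ≤ l)
    {E : Set (Euc N)} (hE : MeasurableSet E) :
    attractive t ((fun x : Euc N => l⁻¹ • x) ⁻¹' E) ≤ ENNReal.ofReal (l ^ N) * attractive t E := by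
  have hl0 : 0 < l := by linarith
  rcases ht.eq_or_lt with rfl | ht
  · rw [attractive_one, attractive_one, mul_left_comm]
    gcongr
    refine (perimeter_smul_le E hl0 hN).trans ?_
    exact mul_le_mul_left (ENNReal.ofReal_le_ofReal (pow_le_pow_right₀ hl (Nat.sub_le N 1))) _
  · rw [attractive_of_lt ht, attractive_of_lt ht, mul_left_comm, fracPerimeter_smul t hl0 hE]
    gcongr
    rw [← Real.rpow_natCast]
    exact Real.rpow_le_rpow_of_exponent_le hl (by linarith)

lemma repulsive_le_smul {s : ℝ} (hs0 : 0 ≤ s) (hs : s ≤ 1) (hN : 1 ≤ N) {l : ℝ} (hl : 1 ≤ l)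
    {E : Set (Euc N)} (hE : MeasurableSet E) :
    repulsive s E ≤ repulsive s ((fun x : Euc N => l⁻¹ • x) ⁻¹' E) := by
  have hl0 : 0 < l := by linarith
  have hN' : (1 : ℝ) ≤ N := by exact_mod_cast hN
  rcases hs0.eq_or_lt with rfl | hs0
  · rw [repulsive_zero, repulsive_zero, volume_preimage_smul hl0]
    gcongr
    refine le_mul_of_one_le_left' ?_
    rw [← ENNReal.ofReal_one]
    exact ENNReal.ofReal_le_ofReal (one_le_pow₀ hl)
  · rw [repulsive_of_pos hs0, repulsive_of_pos hs0, fracPerimeter_smul s hl0 hE]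
    gcongr
    refine le_mul_of_one_le_left' ?_
    rw [← ENNReal.ofReal_one]
    exact ENNReal.ofReal_le_ofReal (Real.one_le_rpow hl (by linarith))

/-! ### Cutting along spheres -/

lemma exists_perimeter_cut_le : ∃ C : ℝ, 0 < C ∧ ∀ {N : ℕ} {F : Set (Euc N)}, MeasurableSet F →
    ∀ {ρ d K : ℝ}, 0 < ρ → 0 < d → 0 ≤ K →
    volume.real (F ∩ closedBall 0 (ρ + d)) - volume.real (F ∩ closedBall 0 ρ) < K * d →
    ∃ r ∈ Set.Icc ρ (ρ + d), perimeter (F ∩ closedBall 0 r) + perimeter (F \ closedBall 0 r) ≤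
      perimeter F + ENNReal.ofReal (C * K) := by
  obtain ⟨C, hC0, hC⟩ := exists_perimeter_inter_add_diff_le
  refine ⟨C, hC0, fun {N F} hF {ρ d K} hρ hd hK0 hK => ?_⟩
  obtain ⟨r, hr, h⟩ := exists_radius hF hd hK
  exact ⟨r, hr, hC hF (hρ.trans_le hr.1) hK0 h⟩

/-- Every volume is attained by a set whose perimeter is finite. -/
lemma exists_perimeter_ne_top (hN : 1 ≤ N) {m : ℝ} (hm : 0 < m) :
    ∃ E : Set (Euc N), MeasurableSet E ∧ volume E = ENNReal.ofReal m ∧ perimeter E ≠ ∞ := by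
  obtain ⟨C, hC0, hC⟩ := exists_perimeter_cut_le
  -- Cutting the whole space, whose perimeter is 0, yields a ball of finite perimeter with radius in
  -- [1, 2]; dilation then adjusts its volume.
  set K : ℝ := max 0 (volume.real ((Set.univ : Set (Euc N)) ∩ closedBall 0 (1 + 1)) -
    volume.real ((Set.univ : Set (Euc N)) ∩ closedBall 0 1) + 1)
  obtain ⟨r, hr, h⟩ := hC (F := (Set.univ : Set (Euc N))) MeasurableSet.univ one_pos one_pos
    (K := K) (le_max_left _ _)
    (by rw [mul_one]; exact lt_of_lt_of_le (by linarith) (le_max_right _ _))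
  rw [perimeter_univ, zero_add, Set.univ_inter] at h
  have hP : perimeter (closedBall (0 : Euc N) r) ≠ ∞ :=
    ((le_self_add.trans h).trans_lt ENNReal.ofReal_lt_top).ne
  set v := volume.real (closedBall (0 : Euc N) r) with hv
  have hr0 : 0 < r := by linarith [hr.1]
  have hv0 : 0 < v := ENNReal.toReal_pos (measure_closedBall_pos _ _ hr0).ne'
    measure_closedBall_lt_top.ne
  have hl : 0 < (m / v) ^ ((N : ℝ)⁻¹) := by positivity
  refine ⟨(fun x : Euc N => ((m / v) ^ ((N : ℝ)⁻¹))⁻¹ • x) ⁻¹' closedBall 0 r, ?_, ?_, ?_⟩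
  · have := measurableSet_closedBall (x := (0 : Euc N)) (ε := r)
    exact (measurable_const_smul _) this
  · rw [volume_preimage_smul hl, Real.rpow_inv_natCast_pow (by positivity) (by omega),
      ← ENNReal.ofReal_toReal (measure_closedBall_lt_top (μ := (volume : Measure (Euc N)))).ne,
      ← ENNReal.ofReal_mul (by positivity)]
    congr 1
    exact div_mul_cancel₀ m hv0.ne'
  · exact ((perimeter_smul_le _ hl hN).trans_lt
      (ENNReal.mul_lt_top ENNReal.ofReal_lt_top hP.lt_top)).ne

lemma exists_attractive_ne_top (hN : 1 ≤ N) {t m : ℝ} (ht0 : 0 < t) (ht : t ≤ 1) (hm : 0 < m) :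
    ∃ E : Set (Euc N), MeasurableSet E ∧ volume E = ENNReal.ofReal m ∧ attractive t E ≠ ∞ := by
  obtain ⟨E, hE, hv, hP⟩ := exists_perimeter_ne_top hN hm
  refine ⟨E, hE, hv, ?_⟩
  rcases ht.eq_or_lt with rfl | ht
  · rw [attractive_one]; exact ENNReal.mul_ne_top sphereConst_ne_top hP
  · have hv' : volume E ≠ ∞ := by rw [hv]; exact ENNReal.ofReal_ne_top
    rw [attractive_of_lt ht]
    refine ENNReal.mul_ne_top ENNReal.ofReal_ne_top ?_
    exact ((fracPerimeter_le_of_perimeter t hE hv').trans_lt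
      (ENNReal.mul_lt_top (truncConst_lt_top hN ht0 ht)
        (ENNReal.add_lt_top.2 ⟨hP.lt_top, hv'.lt_top⟩))).ne

/-- The cost of a cut is the sphere's trace on F when t = 1 and twice the interaction of the pieces
when t < 1. In both cases a mean value over the radii bounds it by the volume beyond ρ divided by d.
-/
lemma exists_attractive_cut_le (hN : 1 ≤ N) {t : ℝ} (ht0 : 0 < t) (ht : t ≤ 1) :
    ∃ C : ℝ, 0 < C ∧ ∀ {F : Set (Euc N)}, MeasurableSet F → volume F ≠ ∞ →
    ∀ {ρ d : ℝ}, 0 < ρ → 0 < d → d ≤ 1 → 0 < volume.real (F \ closedBall 0 ρ) →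
    ∃ r ∈ Set.Icc ρ (ρ + d), attractive t (F ∩ closedBall 0 r) + attractive t (F \ closedBall 0 r) ≤
      attractive t F + ENNReal.ofReal (C / d * volume.real (F \ closedBall 0 ρ)) := by
  rcases ht.eq_or_lt with rfl | ht
  · obtain ⟨C, hC0, hC⟩ := exists_perimeter_cut_le
    refine ⟨(sphereConst N).toReal * (2 * C), ?_, fun {F} hF hv {ρ d} hρ hd hd1 hu => ?_⟩
    · have := ENNReal.toReal_pos (sphereConst_ne_zero hN) sphereConst_ne_top
      positivity
    set u := volume.real (F \ closedBall 0 ρ)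
    have hle : volume.real (F ∩ closedBall 0 (ρ + d)) - volume.real (F ∩ closedBall 0 ρ) ≤ u := by
      have h1 : volume.real (F ∩ closedBall 0 (ρ + d)) ≤ volume.real F :=
        measureReal_mono Set.inter_subset_left hv
      have h2 := measureReal_inter_add_sdiff (μ := volume) (s := F)
        (measurableSet_closedBall (x := (0 : Euc N)) (ε := ρ)) hv
      linarith
    -- The factor 2 makes the growth bound strict, since u > 0.
    obtain ⟨r, hr, h⟩ := hC hF hρ hd (K := 2 * u / d) (by positivity)
      (by rw [div_mul_cancel₀ _ hd.ne']; linarith)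
    refine ⟨r, hr, ?_⟩
    simp only [attractive_one, ← mul_add]
    refine (mul_le_mul_right h _).trans_eq ?_
    rw [mul_add]
    congr 1
    rw [← ENNReal.ofReal_toReal (sphereConst_ne_top (N := N)),
      ← ENNReal.ofReal_mul ENNReal.toReal_nonneg, ENNReal.toReal_ofReal ENNReal.toReal_nonneg]
    congr 1; ring
  · have hK := truncConst_lt_top hN ht0 ht
    refine ⟨(1 - t) * 2 * ((truncConst N t).toReal + 1), ?_,
      fun {F} hF hv {ρ d} hρ hd hd1 hu => ?_⟩
    · have : 0 < 1 - t := by linarith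
      positivity
    obtain ⟨r, hr, h⟩ := exists_interaction_cut_le t hF ρ hd hd1
    refine ⟨r, hr, ?_⟩
    have hB : MeasurableSet (closedBall (0 : Euc N) r) := measurableSet_closedBall
    have hadd := fracPerimeter_union t (hF.inter hB) (hF.diff hB) disjoint_inf_sdiff
    rw [Set.inter_union_sdiff] at hadd
    simp only [attractive_of_lt ht, ← mul_add]
    rw [← hadd, mul_add]
    gcongr
    have hfin : volume (F \ closedBall 0 ρ) ≠ ∞ :=
      ((measure_mono Set.sdiff_subset).trans_lt hv.lt_top).ne
    have h1t : 0 < 1 - t := by linarith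
    calc _ ≤ ENNReal.ofReal (1 - t) * (2 * (truncConst N t * volume (F \ closedBall 0 ρ) /
          ENNReal.ofReal d)) := by gcongr
      _ = ENNReal.ofReal ((1 - t) * 2 * (truncConst N t).toReal / d *
            volume.real (F \ closedBall 0 ρ)) := by
          rw [← ENNReal.ofReal_toReal (a := truncConst N t) hK.ne, ← ENNReal.ofReal_toReal hfin,
            ← ENNReal.ofReal_mul (by positivity), ← ENNReal.ofReal_div_of_pos hd,
            two_mul_ofReal,
            ← ENNReal.ofReal_mul h1t.le, ENNReal.toReal_ofReal ENNReal.toReal_nonneg]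
          congr 1
          simp only [Measure.real]; ring
      _ ≤ _ := by
          refine ENNReal.ofReal_le_ofReal ?_
          gcongr
          linarith

/-! ### Interpolation and isoperimetric inequality -/

lemma exists_ofReal_rpow_mul_le {p : ℝ} (hp : 0 < p) {K c : ℝ≥0∞} (hK : K ≠ ∞) (hc : c ≠ 0) :
    ∃ δ : ℝ, 0 < δ ∧ δ ≤ 1 ∧ ENNReal.ofReal (δ ^ p) * K ≤ c := by
  have h1 : Tendsto (fun δ : ℝ => ENNReal.ofReal (δ ^ p) * K) (𝓝[>] 0)
      (𝓝 (ENNReal.ofReal (0 ^ p) * K)) := by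
    refine ENNReal.Tendsto.mul_const ?_ (Or.inr hK)
    refine ENNReal.tendsto_ofReal ?_
    exact ((Real.continuousAt_rpow_const 0 p (Or.inr hp.le)).tendsto).mono_left nhdsWithin_le_nhds
  rw [Real.zero_rpow hp.ne', ENNReal.ofReal_zero, zero_mul] at h1
  obtain ⟨δ, h2, h3⟩ := ((h1.eventually (ge_mem_nhds (pos_iff_ne_zero.2 hc))).and
    (Ioc_mem_nhdsGT (zero_lt_one (α := ℝ)))).exists
  exact ⟨δ, h3.1, h3.2, h2⟩

/-- Interpolation with δ small makes the coefficient of the attractive term as small as desired. The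
value 1/2 leaves half of A_t(G) available against the other errors. -/
lemma exists_repulsive_le (hN : 1 ≤ N) {s t : ℝ} (hs : 0 ≤ s) (hst : s < t) (ht : t ≤ 1) :
    ∃ C : ℝ≥0∞, C ≠ ∞ ∧ ∀ {E : Set (Euc N)}, MeasurableSet E → volume E ≠ ∞ →
      repulsive s E ≤ 2⁻¹ * attractive t E + C * volume E := by
  rcases hs.eq_or_lt with rfl | hs
  · exact ⟨sphereConst N, sphereConst_ne_top, fun {E} _ _ => by
      rw [repulsive_zero]; exact le_add_self⟩
  have hs1 : s < 1 := hst.trans_le ht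
  have hof : ENNReal.ofReal s ≤ 1 := by
    rw [← ENNReal.ofReal_one]; exact ENNReal.ofReal_le_ofReal hs1.le
  have hKs := truncConst_lt_top hN hs hs1
  rcases ht.eq_or_lt with rfl | ht
  -- P is reached through an intermediate exponent s', since interpolation compares fractional
  -- perimeters and `truncConst` is finite only below 1.
  · obtain ⟨s', hs', hs'1⟩ := exists_between hs1
    have hK := truncConst_lt_top hN (hs.trans hs') hs'1
    obtain ⟨δ, hδ, hδ1, hδK⟩ := exists_ofReal_rpow_mul_le (p := s' - s) (by linarith) hK.ne
      (c := 2⁻¹ * sphereConst N) (mul_ne_zero (by simp) (sphereConst_ne_zero hN))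
    refine ⟨2⁻¹ * sphereConst N + ENNReal.ofReal δ⁻¹ * truncConst N s, ?_, fun {E} hE hv => ?_⟩
    · have := sphereConst_ne_top (N := N)
      finiteness
    rw [repulsive_of_pos hs, attractive_one]
    calc ENNReal.ofReal s * fracPerimeter s E ≤ fracPerimeter s E := mul_le_of_le_one_left' hof
      _ ≤ ENNReal.ofReal (δ ^ (s' - s)) * (truncConst N s' * (perimeter E + volume E))
          + ENNReal.ofReal δ⁻¹ * truncConst N s * volume E := by
          refine (fracPerimeter_interp hs hs'.le hδ hδ1 hE).trans ?_
          gcongr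
          exact fracPerimeter_le_of_perimeter s' hE hv
      _ ≤ (2⁻¹ * sphereConst N) * (perimeter E + volume E)
          + ENNReal.ofReal δ⁻¹ * truncConst N s * volume E := by
          rw [← mul_assoc]; gcongr
      _ = _ := by ring
  · obtain ⟨δ, hδ, hδ1, hδK⟩ := exists_ofReal_rpow_mul_le (p := t - s) (by linarith)
      ENNReal.one_ne_top (c := 2⁻¹ * ENNReal.ofReal (1 - t))
      (mul_ne_zero (by simp) (by simpa using ht))
    refine ⟨ENNReal.ofReal δ⁻¹ * truncConst N s, by finiteness, fun {E} hE hv => ?_⟩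
    rw [repulsive_of_pos hs, attractive_of_lt ht]
    refine (mul_le_of_le_one_left' hof).trans ?_
    refine (fracPerimeter_interp hs hst.le hδ hδ1 hE).trans ?_
    rw [← mul_assoc]
    gcongr
    simpa using hδK

lemma exists_rpow_le_fracPerimeter (hN : 1 ≤ N) {α : ℝ} (hα : 0 < α) (hα1 : α < 1) :
    ∃ c : ℝ, 0 < c ∧ ∀ {E : Set (Euc N)}, MeasurableSet E → volume E ≠ ∞ →
      ENNReal.ofReal (c * volume.real E ^ (1 - α / N)) ≤ fracPerimeter α E := by
  have hN0 : (N : ℝ) ≠ 0 := by exact_mod_cast (by omega : N ≠ 0)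
  set ω := volume.real (ball (0 : Euc N) 1) with hω
  have hω0 : 0 < ω := ENNReal.toReal_pos (measure_ball_pos _ _ one_pos).ne' measure_ball_lt_top.ne
  refine ⟨(2 / ω) ^ (-(1 + α / N)), by positivity, fun {E} hE hv => ?_⟩
  set v := volume.real E with hv'
  rcases (measureReal_nonneg (μ := volume) (s := E)).eq_or_lt with h0 | h0
  · rw [← hv'] at h0
    have he : 1 - α / N ≠ 0 := by
      have : (1 : ℝ) ≤ N := by exact_mod_cast hN
      have : α / N < 1 := by rw [div_lt_one (by linarith)]; linarith
      linarith
    rw [← h0, Real.zero_rpow he, mul_zero, ENNReal.ofReal_zero]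
    exact zero_le
  rw [← hv'] at h0
  -- The ball of radius ρ has volume exactly 2v.
  set ρ : ℝ := (2 * v / ω) ^ ((N : ℝ)⁻¹) with hρ
  have hρ0 : 0 < ρ := by positivity
  have hρN : ρ ^ N = 2 * v / ω := Real.rpow_inv_natCast_pow (by positivity) (by omega)
  have hvE : volume E = ENNReal.ofReal v := (ENNReal.ofReal_toReal hv).symm
  have hball : 2 * volume E ≤ volume (ball (0 : Euc N) ρ) := by
    rw [Measure.addHaar_ball_of_pos _ _ hρ0, finrank_euclideanSpace, Fintype.card_fin, hρN, hvE,
      ← ENNReal.ofReal_toReal (measure_ball_lt_top (μ := (volume : Measure (Euc N)))).ne,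
      two_mul_ofReal,
      ← ENNReal.ofReal_mul (by positivity)]
    refine ENNReal.ofReal_le_ofReal (le_of_eq ?_)
    exact (div_mul_cancel₀ _ hω0.ne').symm
  refine le_trans (le_of_eq ?_) (le_fracPerimeter hα hE hball)
  rw [hvE, ← ENNReal.ofReal_mul (by positivity), ← ENNReal.ofReal_mul (by positivity)]
  congr 1
  have h1 : 1 / ρ ^ ((N : ℝ) + α) = (2 / ω) ^ (-(1 + α / N)) * v ^ (-(1 + α / N)) := by
    rw [one_div, ← Real.rpow_neg hρ0.le, hρ, ← Real.rpow_mul (by positivity),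
      ← Real.mul_rpow (by positivity) h0.le]
    congr 1
    · ring
    · field_simp
  rw [h1, mul_assoc, mul_assoc]
  congr 1
  rw [show (1 : ℝ) - α / N = -(1 + α / N) + 1 + 1 by ring, Real.rpow_add_one h0.ne',
    Real.rpow_add_one h0.ne']
  ring

/-- An isoperimetric inequality for small volumes, common to all `t`. -/
lemma exists_rpow_le_attractive (hN : 1 ≤ N) {t : ℝ} (ht0 : 0 < t) (ht : t ≤ 1) :
    ∃ c β η : ℝ, 0 < c ∧ 0 < β ∧ β < 1 ∧ 0 < η ∧ ∀ {E : Set (Euc N)}, MeasurableSet E →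
      volume E ≠ ∞ → volume.real E ≤ η →
      ENNReal.ofReal (c * volume.real E ^ β) ≤ attractive t E := by
  have hN1 : (1 : ℝ) ≤ N := by exact_mod_cast hN
  have hβ : ∀ α : ℝ, 0 < α → α < 1 → 0 < 1 - α / N ∧ 1 - α / N < 1 := by
    intro α h0 h1
    have : α / N < 1 := by rw [div_lt_one (by linarith)]; linarith
    have : 0 < α / N := by positivity
    constructor <;> linarith
  rcases ht.eq_or_lt with rfl | ht
  -- For t = 1 the bound c v^β ≤ P_{1/2}(E) ≤ K(P(E) + v) suffices, as Kv ≤ (c/2) v^β for small v.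
  -- The exponent is not sharp, but only 0 < β < 1 matters, and β stays positive for N = 1.
  · obtain ⟨c, hc, h⟩ := exists_rpow_le_fracPerimeter hN (α := 1 / 2) (by norm_num) (by norm_num)
    obtain ⟨hβ0, hβ1⟩ := hβ (1 / 2) (by norm_num) (by norm_num)
    set β : ℝ := 1 - 1 / 2 / N
    have hKtop := truncConst_lt_top hN (α := 1 / 2) (by norm_num) (by norm_num)
    set K : ℝ := (truncConst N (1 / 2)).toReal + 1 with hK
    have hK0 : 0 < K := by positivity
    have hKle : truncConst N (1 / 2) ≤ ENNReal.ofReal K := by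
      rw [ENNReal.le_ofReal_iff_toReal_le hKtop.ne hK0.le]; linarith
    set S := (sphereConst N).toReal with hS
    have hS0 : 0 < S := ENNReal.toReal_pos (sphereConst_ne_zero hN) sphereConst_ne_top
    refine ⟨S * (c / (2 * K)), β, (c / (2 * K)) ^ (1 - β)⁻¹, by positivity, hβ0, hβ1,
      by positivity, fun {E} hE hv hη => ?_⟩
    rw [attractive_one]
    by_cases hP : perimeter E = ∞
    · rw [hP, ENNReal.mul_top (sphereConst_ne_zero hN)]; exact le_top
    have hfin := (h hE hv).trans ((fracPerimeter_le_of_perimeter _ hE hv).trans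
      (mul_le_mul_left hKle _))
    set v := volume.real E with hv'
    have hv0 : 0 ≤ v := measureReal_nonneg
    set p := (perimeter E).toReal with hp
    have hp0 : 0 ≤ p := ENNReal.toReal_nonneg
    have hvE : volume E = ENNReal.ofReal v := (ENNReal.ofReal_toReal hv).symm
    have hpE : perimeter E = ENNReal.ofReal p := (ENNReal.ofReal_toReal hP).symm
    have hSE : sphereConst N = ENNReal.ofReal S := (ENNReal.ofReal_toReal sphereConst_ne_top).symm
    rw [hvE, hpE, ← ENNReal.ofReal_add hp0 hv0, ← ENNReal.ofReal_mul hK0.le,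
      ENNReal.ofReal_le_ofReal_iff (by positivity)] at hfin
    have h1 : v ^ (1 - β) ≤ c / (2 * K) := by
      calc v ^ (1 - β) ≤ ((c / (2 * K)) ^ (1 - β)⁻¹) ^ (1 - β) := by gcongr
        _ = _ := Real.rpow_inv_rpow (by positivity) (by linarith)
    have h2 : v = v ^ (1 - β) * v ^ β := by
      rw [← Real.rpow_add' hv0 (by simp)]; simp
    have h3 : v ≤ c / (2 * K) * v ^ β := by
      conv_lhs => rw [h2]
      gcongr
    rw [hpE, hSE, ← ENNReal.ofReal_mul hS0.le]
    refine ENNReal.ofReal_le_ofReal ?_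
    rw [mul_assoc]
    gcongr
    have h4 : K * v ≤ c / 2 * v ^ β := by
      calc K * v ≤ K * (c / (2 * K) * v ^ β) := by gcongr
        _ = _ := by field_simp
    rw [div_mul_eq_mul_div, div_le_iff₀ (by positivity)]
    linarith
  · obtain ⟨c, hc, h⟩ := exists_rpow_le_fracPerimeter hN ht0 ht
    have h1t : 0 < 1 - t := by linarith
    obtain ⟨hβ0, hβ1⟩ := hβ t ht0 ht
    refine ⟨(1 - t) * c, 1 - t / N, 1, by positivity, hβ0, hβ1, one_pos, fun {E} hE hv _ => ?_⟩
    rw [attractive_of_lt ht, mul_assoc, ENNReal.ofReal_mul h1t.le]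
    gcongr
    exact h hE hv

/-! ### Minimality -/

lemma repulsive_ne_top (hN : 1 ≤ N) {s t : ℝ} (hs : 0 ≤ s) (hst : s < t) (ht : t ≤ 1)
    {E : Set (Euc N)} (hE : MeasurableSet E) (hv : volume E ≠ ∞) (hA : attractive t E ≠ ∞) :
    repulsive s E ≠ ∞ := by
  obtain ⟨C, hC, h⟩ := exists_repulsive_le hN hs hst ht
  exact ne_top_of_le_ne_top (by finiteness) (h hE hv)

lemma IsVolumeMinimizer.congr {s t m : ℝ} {F F' : Set (Euc N)} (hF : IsVolumeMinimizer s t m F)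
    (h : F =ᵐ[volume] F') : IsVolumeMinimizer s t m F' where
  nullMeasurableSet := hF.nullMeasurableSet.congr h
  volume_eq := by rw [← measure_congr h, hF.volume_eq]
  energy_eq := by
    rw [← hF.energy_eq]
    simp only [energy, attractive_congr t h, repulsive_congr s h]

lemma IsVolumeMinimizer.energy_le {s t m : ℝ} {F E : Set (Euc N)}
    (hF : IsVolumeMinimizer s t m F) (hE : NullMeasurableSet E volume)
    (hv : volume E = ENNReal.ofReal m) : energy s t F ≤ energy s t E := by
  rw [hF.energy_eq]
  exact iInf_le_of_le E <| iInf_le_of_le hE <| iInf_le_of_le hv le_rfl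

/-- Otherwise the infimum would be `⊤`, whereas some competitor has finite attractive term and hence
energy below `⊤`. -/
lemma IsVolumeMinimizer.attractive_ne_top (hN : 1 ≤ N) {s t m : ℝ} (ht0 : 0 < t)
    (ht : t ≤ 1) (hm : 0 < m) {F : Set (Euc N)} (hF : IsVolumeMinimizer s t m F) :
    attractive t F ≠ ∞ := by
  obtain ⟨E, hE, hv, hA⟩ := exists_attractive_ne_top (N := N) hN ht0 ht hm
  intro h
  have hle := hF.energy_le hE.nullMeasurableSet hv
  simp only [energy, if_pos h, if_neg hA, top_le_iff] at hle
  lift attractive t E to NNReal using hA with a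
  have h1 : ((a : ℝ≥0∞) : EReal) - (repulsive s E : EReal) ≤ (((a : NNReal) : ℝ≥0∞) : EReal) := by
    refine EReal.sub_le_of_le_add ?_
    exact le_add_of_nonneg_right (EReal.coe_ennreal_nonneg _)
  rw [hle, top_le_iff] at h1
  exact absurd h1 (by simp)

/-- Minimality, as an inequality between finite quantities. -/
lemma IsVolumeMinimizer.attractive_add_repulsive_le (hN : 1 ≤ N) {s t m : ℝ} (hs : 0 ≤ s)
    (hst : s < t) (ht : t ≤ 1) (hm : 0 < m) {F E : Set (Euc N)} (hFm : MeasurableSet F)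
    (hF : IsVolumeMinimizer s t m F) (hE : MeasurableSet E) (hv : volume E = ENNReal.ofReal m)
    (hA : attractive t E ≠ ∞) :
    attractive t F + repulsive s E ≤ attractive t E + repulsive s F := by
  have hAF := hF.attractive_ne_top hN (hs.trans_lt hst) ht hm
  have hRF := repulsive_ne_top hN hs hst ht hFm (by rw [hF.volume_eq]; simp) hAF
  have hRE := repulsive_ne_top hN hs hst ht hE (by rw [hv]; simp) hA
  have hle := hF.energy_le hE.nullMeasurableSet hv
  simp only [energy, if_neg hAF, if_neg hA] at hle
  rw [← ENNReal.ofReal_toReal hAF, ← ENNReal.ofReal_toReal hRF, ← ENNReal.ofReal_toReal hRE,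
    ← ENNReal.ofReal_toReal hA] at hle ⊢
  simp only [EReal.coe_ennreal_ofReal, max_eq_left ENNReal.toReal_nonneg] at hle
  rw [← ENNReal.ofReal_add (by positivity) (by positivity),
    ← ENNReal.ofReal_add (by positivity) (by positivity)]
  refine ENNReal.ofReal_le_ofReal ?_
  have : (attractive t F).toReal - (repulsive s F).toReal ≤
      (attractive t E).toReal - (repulsive s E).toReal := by exact_mod_cast hle
  linarith

/-! ### Essential boundedness. -/

/-- De Giorgi iteration: a superlinear decay estimate forces a function to vanish. -/
lemma exists_eq_zero_of_rpow_le {u : ℝ → ℝ} (hu0 : ∀ r, 0 ≤ u r) (hanti : Antitone u)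
    (hlim : Tendsto u atTop (𝓝 0)) {β C ρ₀ : ℝ} (hβ0 : 0 < β) (hβ1 : β < 1) (hC : 0 < C)
    (h : ∀ ρ ≥ ρ₀, ∀ d, 0 < d → d ≤ 1 → u (ρ + d) ^ β ≤ C / d * u ρ) : ∃ r, u r = 0 := by
  have hβ' : 0 < 1 - β := by linarith
  -- The steps d = 2^(-(k+1)) cost a factor 2^(k+1). The ratio q satisfies q^(1-β) = 1/2 to offset
  -- its growth, and δ below is the threshold that closes the induction u ≤ δ q^k.
  set q : ℝ := (1 / 2) ^ (1 - β)⁻¹ with hq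
  have hq0 : 0 < q := by positivity
  have hq1 : q < 1 := Real.rpow_lt_one (by norm_num) (by norm_num) (by positivity)
  have hqβ : q ^ (1 - β) = 1 / 2 := Real.rpow_inv_rpow (by norm_num) hβ'.ne'
  set δ : ℝ := (q ^ β / (2 * C)) ^ (1 - β)⁻¹ with hδ
  have hδ0 : 0 < δ := by positivity
  have hδβ : δ ^ (1 - β) = q ^ β / (2 * C) := Real.rpow_inv_rpow (by positivity) hβ'.ne'
  obtain ⟨ρ₁, hρ₁, hρ₁'⟩ :=
    ((hlim.eventually (ge_mem_nhds hδ0)).and (eventually_ge_atTop ρ₀)).exists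
  have hsplit : ∀ x : ℝ, 0 < x → x ^ (1 - β) * x ^ β = x := fun x hx => by
    rw [← Real.rpow_add hx]; simp
  have key : ∀ k : ℕ, u (ρ₁ + (1 - (1 / 2) ^ k)) ≤ δ * q ^ k := by
    intro k
    induction k with
    | zero => simpa using hρ₁
    | succ k ih =>
      have hk : (0 : ℝ) < (1 / 2) ^ (k + 1) := by positivity
      have hk1 : ((1 : ℝ) / 2) ^ k ≤ 1 := pow_le_one₀ (by norm_num) (by norm_num)
      have hstep := h (ρ₁ + (1 - (1 / 2) ^ k)) (by linarith) ((1 / 2) ^ (k + 1)) hk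
        (pow_le_one₀ (by norm_num) (by norm_num))
      have he : ρ₁ + (1 - (1 / 2 : ℝ) ^ k) + (1 / 2) ^ (k + 1) = ρ₁ + (1 - (1 / 2) ^ (k + 1)) := by
        ring
      rw [he] at hstep
      refine (Real.rpow_le_rpow_iff (hu0 _) (by positivity) hβ0).1 (hstep.trans ?_)
      have hx : δ * q ^ k = (δ ^ (1 - β) * (q ^ (1 - β)) ^ k) * (δ * q ^ k) ^ β := by
        rw [Real.rpow_pow_comm hq0.le, ← Real.mul_rpow hδ0.le (by positivity),
          hsplit _ (by positivity)]
      calc C / (1 / 2) ^ (k + 1) * u (ρ₁ + (1 - (1 / 2) ^ k))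
          ≤ C / (1 / 2) ^ (k + 1) * (δ * q ^ k) := by gcongr
        _ = q ^ β * (δ * q ^ k) ^ β := by
            conv_lhs => rw [hx]
            rw [hδβ, hqβ]
            field_simp
            ring
        _ = (δ * q ^ (k + 1)) ^ β := by
            rw [← Real.mul_rpow hq0.le (by positivity)]
            congr 1; ring
  refine ⟨ρ₁ + 1, le_antisymm ?_ (hu0 _)⟩
  have hz : Tendsto (fun k : ℕ => δ * q ^ k) atTop (𝓝 0) := by
    simpa using (tendsto_pow_atTop_nhds_zero_of_lt_one hq0.le hq1).const_mul δ
  refine ge_of_tendsto' hz fun k => (hanti ?_).trans (key k)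
  have : (0 : ℝ) < (1 / 2) ^ k := by positivity
  linarith

lemma tendsto_volume_diff_closedBall {F : Set (Euc N)} (hF : MeasurableSet F)
    (hv : volume F ≠ ∞) :
    Tendsto (fun r : ℝ => volume.real (F \ closedBall 0 r)) atTop (𝓝 0) := by
  have hanti : Antitone fun r : ℝ => F \ closedBall (0 : Euc N) r := fun a b hab => by
    dsimp only; gcongr
  have h := tendsto_measure_iInter_atTop (μ := volume)
    (fun r : ℝ =>
      (hF.diff (measurableSet_closedBall (x := (0 : Euc N)) (ε := r))).nullMeasurableSet)
    hanti ⟨0, ((measure_mono Set.sdiff_subset).trans_lt hv.lt_top).ne⟩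
  have hempty : ⋂ r : ℝ, F \ closedBall (0 : Euc N) r = ∅ := by
    ext x
    simp only [Set.mem_iInter, Set.mem_sdiff, Set.mem_empty_iff_false, iff_false, not_forall]
    exact ⟨‖x‖, fun h => h.2 (by simp)⟩
  rw [hempty, measure_empty] at h
  exact (ENNReal.tendsto_toReal ENNReal.zero_ne_top).comp h

/-- Rescaling to recover the volume: what minimality says about a set cut by a ball. -/
lemma IsVolumeMinimizer.attractive_le_of_cut (hN : 1 ≤ N) {s t m : ℝ} (hs : 0 ≤ s)
    (hst : s < t) (ht : t ≤ 1) (hm : 0 < m) {E G : Set (Euc N)} (hE : MeasurableSet E)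
    (hG : MeasurableSet G) (hEG : Disjoint E G) (hF : IsVolumeMinimizer s t m (E ∪ G))
    (hw : volume.real G < m) (hAE : attractive t E ≠ ∞) :
    attractive t (E ∪ G) ≤
      ENNReal.ofReal (m / (m - volume.real G)) * attractive t E + repulsive s G := by
  have ht0 : 0 < t := hs.trans_lt hst
  have hFm := hE.union hG
  have hFv : volume (E ∪ G) ≠ ∞ := by rw [hF.volume_eq]; simp
  have hEv : volume E ≠ ∞ := ne_top_of_le_ne_top hFv (measure_mono Set.subset_union_left)
  set w := volume.real G with hw'
  have hw0 : 0 ≤ w := measureReal_nonneg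
  have hmw : 0 < m - w := by linarith
  -- The dilation that brings E back to volume m.
  set l : ℝ := (m / (m - w)) ^ ((N : ℝ)⁻¹) with hl
  have hl1 : 1 ≤ l := Real.one_le_rpow (by rw [one_le_div hmw]; linarith) (by positivity)
  have hlN : l ^ N = m / (m - w) := Real.rpow_inv_natCast_pow (by positivity) (by omega)
  have hvE : volume E = ENNReal.ofReal (m - w) := by
    have h1 : volume.real (E ∪ G) = volume.real E + w :=
      measureReal_union hEG hG (h₁ := hEv)
        (h₂ := ne_top_of_le_ne_top hFv (measure_mono Set.subset_union_right))
    have h2 : volume.real (E ∪ G) = m := by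
      rw [Measure.real, hF.volume_eq, ENNReal.toReal_ofReal hm.le]
    rw [← ENNReal.ofReal_toReal hEv]
    congr 1
    change volume.real E = _
    linarith
  set E' : Set (Euc N) := (fun x : Euc N => l⁻¹ • x) ⁻¹' E with hE'
  have hE'm : MeasurableSet E' := (measurable_const_smul _) hE
  have hvE' : volume E' = ENNReal.ofReal m := by
    rw [volume_preimage_smul (by linarith), hlN, hvE, ← ENNReal.ofReal_mul (by positivity),
      div_mul_cancel₀ _ hmw.ne']
  have hAE' := attractive_smul_le ht0.le ht hN hl1 hE
  rw [hlN] at hAE'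
  have hRE' := repulsive_le_smul hs (hst.le.trans ht) hN hl1 hE
  have hRE := repulsive_ne_top hN hs hst ht hE hEv hAE
  have hmin := hF.attractive_add_repulsive_le hN hs hst ht hm hFm hE'm hvE'
    (ne_top_of_le_ne_top (by finiteness) hAE')
  refine (ENNReal.add_le_add_iff_right hRE).1 ?_
  calc attractive t (E ∪ G) + repulsive s E ≤ attractive t (E ∪ G) + repulsive s E' := by gcongr
    _ ≤ attractive t E' + repulsive s (E ∪ G) := hmin
    _ ≤ ENNReal.ofReal (m / (m - w)) * attractive t E + (repulsive s E + repulsive s G) := by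
        gcongr
        exact repulsive_union_le hs hE hG hEG
    _ = _ := by ring

/-- Volume-constrained minimizers are essentially bounded. -/
theorem IsVolumeMinimizer.exists_volume_diff_closedBall_eq_zero (hN : 1 ≤ N) {s t m : ℝ}
    (hs : 0 ≤ s) (hst : s < t) (ht : t ≤ 1) (hm : 0 < m) {F : Set (Euc N)}
    (hFm : MeasurableSet F) (hF : IsVolumeMinimizer s t m F) :
    ∃ r : ℝ, volume (F \ closedBall 0 r) = 0 := by
  have ht0 : 0 < t := hs.trans_lt hst
  have hFv : volume F ≠ ∞ := by rw [hF.volume_eq]; simp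
  have hAF := hF.attractive_ne_top hN ht0 ht hm
  obtain ⟨C₁, hC₁, hcut⟩ := exists_attractive_cut_le hN ht0 ht
  obtain ⟨C₂, hC₂, hrep⟩ := exists_repulsive_le hN hs hst ht
  obtain ⟨c, β, η, hc, hβ0, hβ1, hη, hiso⟩ := exists_rpow_le_attractive hN ht0 ht
  have hβ' : 0 < 1 - β := by linarith
  set u : ℝ → ℝ := fun r => volume.real (F \ closedBall 0 r) with hu
  have hfin : ∀ r, volume (F \ closedBall 0 r) ≠ ∞ := fun r =>
    ne_top_of_le_ne_top hFv (measure_mono Set.sdiff_subset)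
  have hanti : Antitone u := fun a b hab => measureReal_mono (by gcongr) (hfin a)
  have hlim : Tendsto u atTop (𝓝 0) := tendsto_volume_diff_closedBall hFm hFv
  set a := (attractive t F).toReal with ha
  have ha0 : 0 ≤ a := ENNReal.toReal_nonneg
  set D : ℝ := 2 * a / m + C₂.toReal with hD
  have hD0 : 0 ≤ D := by positivity
  -- For w ≤ θ the isoperimetric inequality applies, 2w/m ≤ 1, and the linear error satisfies Dw ≤
  -- (c/4) w^β.
  set θ : ℝ := min (min η (m / 2)) ((c / (4 * (D + 1))) ^ (1 - β)⁻¹) with hθ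
  have hθ0 : 0 < θ := by positivity
  obtain ⟨ρ₀, hρ₀⟩ := eventually_atTop.1
    ((hlim.eventually (ge_mem_nhds hθ0)).and (eventually_gt_atTop 0))
  suffices h : ∃ r, u r = 0 by
    obtain ⟨r, hr⟩ := h
    exact ⟨r, (measureReal_eq_zero_iff (hfin r)).1 hr⟩
  refine exists_eq_zero_of_rpow_le (fun r => measureReal_nonneg) hanti hlim hβ0 hβ1
    (C := 8 * C₁ / c) (ρ₀ := ρ₀) (by positivity) fun ρ hρ d hd hd1 => ?_
  obtain ⟨huρ, hρ0⟩ := hρ₀ ρ hρ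
  rcases (measureReal_nonneg (μ := volume) (s := F \ closedBall 0 ρ)).eq_or_lt with h0 | h0
  · have h1 : u (ρ + d) = 0 :=
      le_antisymm ((hanti (by linarith : ρ ≤ ρ + d)).trans h0.symm.le) measureReal_nonneg
    have h2 : u ρ = 0 := h0.symm
    rw [h1, h2, Real.zero_rpow hβ0.ne', mul_zero]
  obtain ⟨r, hr, hr'⟩ := hcut hFm hFv hρ0 hd hd1 h0
  set E := F ∩ closedBall 0 r with hE
  set G := F \ closedBall 0 r with hG
  have hB : MeasurableSet (closedBall (0 : Euc N) r) := measurableSet_closedBall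
  have hEm : MeasurableSet E := hFm.inter hB
  have hGm : MeasurableSet G := hFm.diff hB
  have hEG : E ∪ G = F := Set.inter_union_sdiff _ _
  set w := volume.real G with hw
  have hw0 : 0 ≤ w := measureReal_nonneg
  have hwρ : w ≤ u ρ := hanti hr.1
  have hwθ : w ≤ θ := hwρ.trans huρ
  have hwm : w ≤ m / 2 := hwθ.trans ((min_le_left _ _).trans (min_le_right _ _))
  have hwη : w ≤ η := hwθ.trans ((min_le_left _ _).trans (min_le_left _ _))
  have hsum : attractive t E + attractive t G ≠ ∞ := ne_top_of_le_ne_top (by finiteness) hr'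
  have hAE : attractive t E ≠ ∞ := ne_top_of_le_ne_top hsum le_self_add
  have hAG : attractive t G ≠ ∞ := ne_top_of_le_ne_top hsum le_add_self
  have hmin := IsVolumeMinimizer.attractive_le_of_cut hN hs hst ht hm hEm hGm
    disjoint_inf_sdiff (hEG ▸ hF) (show w < m by linarith) hAE
  rw [hEG] at hmin
  have hmin' := hmin.trans (add_le_add_right (hrep hGm (hfin r)) _)
  have hiso' := hiso hGm (hfin r) hwη
  set e := (attractive t E).toReal with he
  set g := (attractive t G).toReal with hg
  have he0 : 0 ≤ e := ENNReal.toReal_nonneg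
  have hg0 : 0 ≤ g := ENNReal.toReal_nonneg
  have eA : attractive t F = ENNReal.ofReal a := (ENNReal.ofReal_toReal hAF).symm
  have eE : attractive t E = ENNReal.ofReal e := (ENNReal.ofReal_toReal hAE).symm
  have eG : attractive t G = ENNReal.ofReal g := (ENNReal.ofReal_toReal hAG).symm
  have eC : C₂ = ENNReal.ofReal C₂.toReal := (ENNReal.ofReal_toReal hC₂).symm
  have eV : volume G = ENNReal.ofReal w := (ENNReal.ofReal_toReal (hfin r)).symm
  have e2 : (2⁻¹ : ℝ≥0∞) = ENNReal.ofReal (1 / 2) := by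
    rw [one_div, ENNReal.ofReal_inv_of_pos two_pos, ENNReal.ofReal_ofNat]
  have hC₂0 : 0 ≤ C₂.toReal := ENNReal.toReal_nonneg
  have hmw : 0 < m - w := by linarith
  set J : ℝ := C₁ / d * u ρ with hJ
  have hJ0 : 0 ≤ J := by
    have : 0 ≤ u ρ := h0.le
    positivity
  have r1 : e + g ≤ a + J := by
    rw [eE, eG, eA, ← ENNReal.ofReal_add he0 hg0, ← ENNReal.ofReal_add ha0 hJ0] at hr'
    exact (ENNReal.ofReal_le_ofReal_iff (by positivity)).1 hr'
  have r2 : a ≤ m / (m - w) * e + (1 / 2 * g + C₂.toReal * w) := by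
    rw [eE, eG, eA, eC, eV, e2] at hmin'
    rw [← ENNReal.ofReal_mul (by positivity), ← ENNReal.ofReal_mul (by positivity),
      ← ENNReal.ofReal_mul hC₂0, ← ENNReal.ofReal_add (by positivity) (by positivity),
      ← ENNReal.ofReal_add (by positivity) (by positivity)] at hmin'
    exact (ENNReal.ofReal_le_ofReal_iff (by positivity)).1 hmin'
  have r3 : c * w ^ β ≤ g := by
    rw [eG] at hiso'
    exact (ENNReal.ofReal_le_ofReal_iff hg0).1 hiso'
  have r4 : m / (m - w) ≤ 1 + 2 * w / m := by
    rw [div_le_iff₀ hmw]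
    have : (1 + 2 * w / m) * (m - w) = m + w * (m - 2 * w) / m := by field_simp; ring
    rw [this]
    have : 0 ≤ w * (m - 2 * w) / m := by
      have : 0 ≤ m - 2 * w := by linarith
      positivity
    linarith
  have r5 : m / (m - w) * e ≤ e + 2 * w / m * a + J := by
    have h1 : 2 * w / m ≤ 1 := by rw [div_le_one hm]; linarith
    have h2 : 0 ≤ 2 * w / m := by positivity
    calc m / (m - w) * e ≤ (1 + 2 * w / m) * e := by gcongr
      _ = e + 2 * w / m * e := by ring
      _ ≤ e + 2 * w / m * (a + J) := by gcongr; linarith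
      _ ≤ _ := by nlinarith
  -- Inserting `r5` and then e ≤ a + J - g from `r1` into `r2` cancels a and leaves g/2 ≤ Dw + 2J.
  have r6 : c * w ^ β ≤ 2 * D * w + 4 * J := by
    have : 2 * D * w = 2 * (2 * w / m * a + C₂.toReal * w) := by rw [hD]; ring
    rw [this]; linarith
  have r7 : D * w ≤ c / 4 * w ^ β := by
    have h1 : w ^ (1 - β) ≤ c / (4 * (D + 1)) := by
      calc w ^ (1 - β) ≤ ((c / (4 * (D + 1))) ^ (1 - β)⁻¹) ^ (1 - β) := by
            gcongr; exact hwθ.trans (min_le_right _ _)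
        _ = _ := Real.rpow_inv_rpow (by positivity) hβ'.ne'
    have h2 : w = w ^ (1 - β) * w ^ β := by
      rw [← Real.rpow_add' hw0 (by simp)]; simp
    calc D * w ≤ (D + 1) * (w ^ (1 - β) * w ^ β) := by rw [← h2]; gcongr; linarith
      _ ≤ (D + 1) * (c / (4 * (D + 1)) * w ^ β) := by gcongr
      _ = _ := by field_simp
  have r8 : w ^ β ≤ 8 * C₁ / c / d * u ρ := by
    have : 8 * C₁ / c / d * u ρ = 8 * J / c := by rw [hJ]; field_simp
    rw [this, le_div_iff₀ hc]
    linarith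
  refine le_trans ?_ r8
  exact Real.rpow_le_rpow measureReal_nonneg (hanti hr.2) hβ0.le

/-! ### Essential connectedness for t = 1. -/

lemma volume_preimage_sub {E : Set (Euc N)} (hE : MeasurableSet E) (h : Euc N) :
    volume ((fun x : Euc N => x - h) ⁻¹' E) = volume E :=
  (measurePreserving_sub_right (volume : Measure (Euc N)) h).measure_preimage hE.nullMeasurableSet

lemma fracPerimeter_preimage_sub (α : ℝ) {E : Set (Euc N)} (hE : MeasurableSet E) (h : Euc N) :
    fracPerimeter α ((fun x : Euc N => x - h) ⁻¹' E) = fracPerimeter α E := by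
  have hm : ∀ z : Euc N, MeasurableSet ((fun x : Euc N => x - z) ⁻¹' E) := fun z =>
    (measurable_sub_const z) hE
  rw [fracPerimeter_eq_lintegral α (hm h), fracPerimeter_eq_lintegral α hE]
  refine lintegral_congr fun z => ?_
  rw [← volume_preimage_sub (hE.diff (hm z)) h]
  congr 2
  ext x
  simp only [Set.mem_sdiff, Set.mem_preimage, sub_right_comm]

lemma interaction_pos (α : ℝ) {A B : Set (Euc N)} (h : Disjoint A B)
    (hA0 : volume A ≠ 0) (hB0 : volume B ≠ 0) : 0 < interaction α A B := by
  have hm : Measurable fun x : Euc N => ∫⁻ y in B, kernel α (x - y) :=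
    Measurable.lintegral_prod_right' (f := fun p : Euc N × Euc N => kernel α (p.1 - p.2))
      (by fun_prop)
  unfold interaction
  rw [setLIntegral_pos_iff hm]
  refine (pos_iff_ne_zero.2 hA0).trans_le (measure_mono fun x hx => ⟨?_, hx⟩)
  rw [Function.mem_support, ← pos_iff_ne_zero, setLIntegral_pos_iff (by fun_prop)]
  refine (pos_iff_ne_zero.2 hB0).trans_le (measure_mono fun y hy => ⟨?_, hy⟩)
  exact (kernel_pos (sub_ne_zero.2 (Set.disjoint_iff_forall_ne.1 h hx hy))).ne'

lemma interaction_le_of_dist (α : ℝ) (hα : 0 < α) {R : ℝ} (hR : 0 < R) {A B : Set (Euc N)}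
    (hA : MeasurableSet A) (hB : MeasurableSet B) (h : ∀ x ∈ A, ∀ y ∈ B, R ≤ ‖x - y‖) :
    interaction α A B ≤ ENNReal.ofReal (1 / R ^ ((N : ℝ) + α)) * volume B * volume A := by
  unfold interaction
  rw [← setLIntegral_const]
  refine setLIntegral_mono' hA fun x hx => ?_
  rw [← setLIntegral_const]
  refine setLIntegral_mono' hB fun y hy => ENNReal.ofReal_le_ofReal ?_
  have := h x hx y hy
  gcongr

lemma perimeter_ne_zero (hN : 1 ≤ N) {E : Set (Euc N)} (hE : MeasurableSet E)
    (hv : volume E ≠ ∞) (hv0 : volume E ≠ 0) : perimeter E ≠ 0 := by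
  intro h0
  obtain ⟨c, hc, h⟩ := exists_rpow_le_fracPerimeter hN (α := 1 / 2) (by norm_num) (by norm_num)
  have h1 := h hE hv
  rw [fracPerimeter_eq_zero_of_perimeter _ hE hv h0, nonpos_iff_eq_zero,
    ENNReal.ofReal_eq_zero] at h1
  have : 0 < volume.real E := ENNReal.toReal_pos hv0 hv
  have : 0 < c * volume.real E ^ (1 - 1 / 2 / (N : ℝ)) := by positivity
  linarith

/-- The dilate of A to volume m, by a factor l > 1, gives P(F) ≤ l^(N-1) P(A), and l^(N-1) < l^N =
m/|A|. -/
lemma IsVolumeMinimizer.perimeter_mul_lt (hN : 1 ≤ N) {m : ℝ} (hm : 0 < m) {F A : Set (Euc N)}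
    (hFm : MeasurableSet F) (hF : IsVolumeMinimizer 0 1 m F) (hP : perimeter F ≠ ∞)
    (hA : MeasurableSet A) (hPA : perimeter A ≠ ∞) (hA0 : 0 < volume.real A)
    (hAm : volume.real A < m) :
    (perimeter F).toReal * volume.real A < m * (perimeter A).toReal := by
  set v := volume.real A with hv
  have hAv : volume A ≠ ∞ := (ENNReal.toReal_pos_iff.1 hA0).2.ne
  set l : ℝ := (m / v) ^ ((N : ℝ)⁻¹) with hl
  have hN' : (N : ℝ) ≠ 0 := by exact_mod_cast (by omega : N ≠ 0)
  have hl1 : 1 < l := Real.one_lt_rpow (by rwa [one_lt_div hA0]) (by positivity)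
  have hlN : l ^ N = m / v := Real.rpow_inv_natCast_pow (by positivity) (by omega)
  have hvE : volume ((fun x : Euc N => l⁻¹ • x) ⁻¹' A) = ENNReal.ofReal m := by
    rw [volume_preimage_smul (by linarith), hlN, ← ENNReal.ofReal_toReal hAv,
      ← ENNReal.ofReal_mul (by positivity)]
    congr 1
    exact div_mul_cancel₀ _ hA0.ne'
  have hle := perimeter_smul_le A (by linarith : 0 < l) hN
  have hPE : perimeter ((fun x : Euc N => l⁻¹ • x) ⁻¹' A) ≠ ∞ :=
    ne_top_of_le_ne_top (by finiteness) hle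
  have hS := sphereConst_ne_top (N := N)
  have hmin := hF.attractive_add_repulsive_le hN le_rfl one_pos le_rfl hm hFm
    ((measurable_const_smul _) hA) hvE (by rw [attractive_one]; finiteness)
  rw [attractive_one, attractive_one, repulsive_zero, repulsive_zero, hvE, hF.volume_eq,
    ENNReal.add_le_add_iff_right (by finiteness),
    ENNReal.mul_le_mul_iff_right (sphereConst_ne_zero hN) hS] at hmin
  have h1 : (perimeter F).toReal ≤ l ^ (N - 1) * (perimeter A).toReal := by
    have := ENNReal.toReal_mono (by finiteness) (hmin.trans hle)
    rwa [ENNReal.toReal_mul, ENNReal.toReal_ofReal (by positivity)] at this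
  have hpF : 0 < (perimeter F).toReal := by
    refine ENNReal.toReal_pos (perimeter_ne_zero hN hFm ?_ ?_) hP
    · rw [hF.volume_eq]; simp
    · rw [hF.volume_eq]; simpa using hm
  have hpA : 0 < (perimeter A).toReal := by
    by_contra! h0
    have : l ^ (N - 1) * (perimeter A).toReal ≤ 0 :=
      mul_nonpos_of_nonneg_of_nonpos (by positivity) h0
    linarith
  have h2 : l ^ (N - 1) < m / v := by
    rw [← hlN]
    exact pow_lt_pow_right₀ hl1 (by omega)
  calc _ ≤ l ^ (N - 1) * (perimeter A).toReal * v := by gcongr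
    _ < m / v * (perimeter A).toReal * v := by gcongr
    _ = _ := by field_simp

/-- Adding the strict ratio inequalities for A and B gives P(F) m < m (P(A) + P(B)). -/
lemma IsVolumeMinimizer.perimeter_union_ne_of_zero (hN : 1 ≤ N) {m : ℝ} (hm : 0 < m)
    {A B : Set (Euc N)} (hA : MeasurableSet A) (hB : MeasurableSet B) (hAB : Disjoint A B)
    (hF : IsVolumeMinimizer 0 1 m (A ∪ B)) (hA0 : volume A ≠ 0) (hB0 : volume B ≠ 0)
    (hP : perimeter (A ∪ B) ≠ ∞) : perimeter (A ∪ B) ≠ perimeter A + perimeter B := by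
  intro heq
  have hFv : volume (A ∪ B) ≠ ∞ := by rw [hF.volume_eq]; simp
  have hAv : volume A ≠ ∞ := ne_top_of_le_ne_top hFv (measure_mono Set.subset_union_left)
  have hBv : volume B ≠ ∞ := ne_top_of_le_ne_top hFv (measure_mono Set.subset_union_right)
  have hPA : perimeter A ≠ ∞ := ne_top_of_le_ne_top hP (heq ▸ le_self_add)
  have hPB : perimeter B ≠ ∞ := ne_top_of_le_ne_top hP (heq ▸ le_add_self)
  have hA1 : 0 < volume.real A := ENNReal.toReal_pos hA0 hAv
  have hB1 : 0 < volume.real B := ENNReal.toReal_pos hB0 hBv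
  have hsum : volume.real A + volume.real B = m := by
    rw [← measureReal_union hAB hB (h₁ := hAv) (h₂ := hBv), Measure.real, hF.volume_eq,
      ENNReal.toReal_ofReal hm.le]
  have h1 := hF.perimeter_mul_lt hN hm (hA.union hB) hP hA hPA hA1 (by linarith)
  have h2 := hF.perimeter_mul_lt hN hm (hA.union hB) hP hB hPB hB1 (by linarith)
  rw [heq, ENNReal.toReal_add hPA hPB] at h1 h2
  rw [← hsum] at h1 h2
  nlinarith

lemma IsVolumeMinimizer.perimeter_union_ne_of_pos (hN : 1 ≤ N) {s m : ℝ} (hs : 0 < s)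
    (hs1 : s < 1) (hm : 0 < m) {A B : Set (Euc N)} (hA : MeasurableSet A) (hB : MeasurableSet B)
    (hAB : Disjoint A B) {R : ℝ} (hR : 0 ≤ R) (hAR : A ⊆ closedBall 0 R)
    (hBR : B ⊆ closedBall 0 R) (hF : IsVolumeMinimizer s 1 m (A ∪ B)) (hA0 : volume A ≠ 0)
    (hB0 : volume B ≠ 0) : perimeter (A ∪ B) ≠ perimeter A + perimeter B := by
  intro heq
  have hFv : volume (A ∪ B) ≠ ∞ := by rw [hF.volume_eq]; simp
  have hAv : volume A ≠ ∞ := ne_top_of_le_ne_top hFv (measure_mono Set.subset_union_left)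
  have hBv : volume B ≠ ∞ := ne_top_of_le_ne_top hFv (measure_mono Set.subset_union_right)
  have hAF := hF.attractive_ne_top hN one_pos le_rfl hm
  have hRF := repulsive_ne_top hN hs.le hs1 le_rfl (hA.union hB) hFv hAF
  have hs0 : ENNReal.ofReal s ≠ 0 := by simpa using hs
  have key : ∀ n : ℕ, 1 ≤ n → interaction s A B ≤
      ENNReal.ofReal (1 / (n : ℝ) ^ ((N : ℝ) + s)) * volume B * volume A := by
    intro n hn
    have hn0 : (0 : ℝ) < n := by exact_mod_cast hn
    -- Both pieces lie in the ball of radius R, so a shift of length 2R + n puts them at distance at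
    -- least n.
    set h : Euc N := EuclideanSpace.single (⟨0, hN⟩ : Fin N) (2 * R + n) with hh
    have hnorm : ‖h‖ = 2 * R + n := by
      rw [hh, PiLp.norm_single, Real.norm_of_nonneg (by positivity)]
    set B' : Set (Euc N) := (fun x => x - h) ⁻¹' B with hB'
    have hB'm : MeasurableSet B' := (measurable_sub_const h) hB
    have hdist : ∀ x ∈ A, ∀ y ∈ B', (n : ℝ) ≤ ‖x - y‖ := by
      intro x hx y hy
      have h1 : ‖x‖ ≤ R := by simpa using hAR hx
      have h2 : ‖y - h‖ ≤ R := by simpa using hBR hy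
      have h3 : h = x - (y - h) - (x - y) := by abel
      have h4 : ‖h‖ ≤ ‖x‖ + ‖y - h‖ + ‖x - y‖ := by
        conv_lhs => rw [h3]
        exact (norm_sub_le _ _).trans (add_le_add_left (norm_sub_le _ _) _)
      linarith
    have hdisj : Disjoint A B' := Set.disjoint_left.2 fun x hx hx' => by
      have := hdist x hx x hx'
      rw [sub_self, norm_zero] at this
      linarith
    have hvol : volume (A ∪ B') = ENNReal.ofReal m := by
      rw [measure_union hdisj hB'm, volume_preimage_sub hB, ← measure_union hAB hB, hF.volume_eq]
    have hPle : attractive 1 (A ∪ B') ≤ attractive 1 (A ∪ B) := by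
      rw [attractive_one, attractive_one, heq]
      gcongr
      exact (perimeter_union_le hB'm hdisj).trans
        (add_le_add_right (perimeter_preimage_sub_le B h) _)
    have hmin := hF.attractive_add_repulsive_le hN hs.le hs1 le_rfl hm (hA.union hB)
      (hA.union hB'm) hvol (ne_top_of_le_ne_top hAF hPle)
    have hRle : repulsive s (A ∪ B') ≤ repulsive s (A ∪ B) :=
      (ENNReal.add_le_add_iff_left hAF).1 (hmin.trans (add_le_add_left hPle _))
    rw [repulsive_of_pos hs] at hRF
    have hPF : fracPerimeter s (A ∪ B) ≠ ∞ := fun h' => hRF (by rw [h', ENNReal.mul_top hs0])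
    rw [repulsive_of_pos hs, repulsive_of_pos hs,
      ENNReal.mul_le_mul_iff_right hs0 ENNReal.ofReal_ne_top] at hRle
    have e1 := fracPerimeter_union s hA hB hAB
    have e2 := fracPerimeter_union s hA hB'm hdisj
    rw [fracPerimeter_preimage_sub s hB, ← e1] at e2
    -- The sums P_s + 2I for the original and the shifted pair agree, and P_s does not increase
    -- under the shift, so the interaction does not decrease.
    have h5 : 2 * interaction s A B ≤ 2 * interaction s A B' := by
      refine (ENNReal.add_le_add_iff_left hPF).1 ?_
      rw [← e2]
      gcongr
    rw [ENNReal.mul_le_mul_iff_right two_ne_zero ENNReal.ofNat_ne_top] at h5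
    refine h5.trans ((interaction_le_of_dist s hs hn0 hA hB'm hdist).trans_eq ?_)
    rw [volume_preimage_sub hB]
  have hlim : Tendsto (fun n : ℕ => ENNReal.ofReal (1 / (n : ℝ) ^ ((N : ℝ) + s)) * volume B *
      volume A) atTop (𝓝 0) := by
    have h1 : Tendsto (fun n : ℕ => ENNReal.ofReal (1 / (n : ℝ) ^ ((N : ℝ) + s))) atTop (𝓝 0) := by
      rw [← ENNReal.ofReal_zero]
      refine ENNReal.tendsto_ofReal ?_
      simp_rw [one_div]
      exact ((tendsto_rpow_atTop (by positivity)).comp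
        tendsto_natCast_atTop_atTop).inv_tendsto_atTop
    have h2 := ENNReal.Tendsto.mul_const (ENNReal.Tendsto.mul_const h1 (Or.inr hBv)) (Or.inr hAv)
    simpa using h2
  have hle : interaction s A B ≤ 0 :=
    ge_of_tendsto hlim ((eventually_ge_atTop 1).mono fun n hn => key n hn)
  exact (interaction_pos s hAB hA0 hB0).not_ge hle

/-! ### Passage to measurable representatives and conclusion. -/

lemma exists_measurableSet_ae_eq_subset {α : Type*} [MeasurableSpace α] {μ : Measure α}
    {G S : Set α} (hG : NullMeasurableSet G μ) (hS : MeasurableSet S) (h : μ (G \ S) = 0) :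
    ∃ A, MeasurableSet A ∧ A =ᵐ[μ] G ∧ A ⊆ S := by
  refine ⟨toMeasurable μ G ∩ S, (measurableSet_toMeasurable _ _).inter hS, ?_,
    Set.inter_subset_right⟩
  refine (hG.toMeasurable_ae_eq.inter (ae_eq_refl S)).trans ?_
  rw [← Set.sdiff_sdiff_right_self]
  exact sdiff_ae_eq_self.2 (measure_mono_null Set.inter_subset_right h)

end FracPerimeter

end

open FracPerimeter in
theorem mainTheorem7 (N : ℕ) (hN : 1 ≤ N) (s t m : ℝ) (hs : 0 ≤ s) (hst : s < t) (ht : t ≤ 1)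
    (hm : 0 < m) (F : Set (EuclideanSpace ℝ (Fin N)))
    (hF : FracPerimeter.IsVolumeMinimizer s t m F) :
    FracPerimeter.EssBounded F ∧ (t = 1 → FracPerimeter.EssConnected F) := by
  have hae : toMeasurable volume F =ᵐ[volume] F := hF.nullMeasurableSet.toMeasurable_ae_eq
  obtain ⟨r, hr⟩ := (hF.congr hae.symm).exists_volume_diff_closedBall_eq_zero hN hs hst ht hm
    (measurableSet_toMeasurable _ _)
  have hrF : volume (F \ Metric.closedBall 0 r) = 0 :=
    measure_mono_null (Set.sdiff_subset_sdiff_left (subset_toMeasurable _ _)) hr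
  refine ⟨⟨r + 1, measure_mono_null ?_ hrF⟩, ?_⟩
  · exact Set.sdiff_subset_sdiff_right (Metric.closedBall_subset_ball (by linarith))
  rintro rfl ⟨F₁, F₂, h1, h2, hu, hd, h1pos, h2pos, hP⟩
  set R := max r 0
  have hrR : volume (F \ Metric.closedBall 0 R) = 0 :=
    measure_mono_null (Set.sdiff_subset_sdiff_right
      (Metric.closedBall_subset_closedBall (le_max_left _ _))) hrF
  have hball : MeasurableSet (Metric.closedBall (0 : Euc N) R) := measurableSet_closedBall
  obtain ⟨A, hAm, hA, hAR⟩ := exists_measurableSet_ae_eq_subset h1 hball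
    (measure_mono_null (Set.sdiff_subset_sdiff_left (hu ▸ Set.subset_union_left)) hrR)
  obtain ⟨B', hBm', hB', hBR'⟩ := exists_measurableSet_ae_eq_subset h2 hball
    (measure_mono_null (Set.sdiff_subset_sdiff_left (hu ▸ Set.subset_union_right)) hrR)
  -- The representatives are disjoint only up to a null set; removing A makes them disjoint without
  -- changing the class of F₂.
  set B := B' \ A
  have hB : B =ᵐ[volume] F₂ := by
    have := hB'.diff hA
    rwa [hd.symm.sdiff_eq_left] at this
  have hBm : MeasurableSet B := hBm'.diff hAm
  have hFAB : F =ᵐ[volume] (A ∪ B : Set (Euc N)) := by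
    rw [← hu]; exact (hA.union hB).symm
  have hF' := hF.congr hFAB
  have hAB : Disjoint A B := disjoint_sdiff_self_right
  rw [perimeter_congr hFAB, ← perimeter_congr hA, ← perimeter_congr hB] at hP
  rw [← measure_congr hA] at h1pos
  rw [← measure_congr hB] at h2pos
  rcases hs.eq_or_lt with rfl | hs
  · refine hF'.perimeter_union_ne_of_zero hN hm hAm hBm hAB h1pos.ne' h2pos.ne' ?_ hP
    intro htop
    refine hF'.attractive_ne_top hN one_pos le_rfl hm ?_
    rw [attractive_one, htop, ENNReal.mul_top (sphereConst_ne_zero hN)]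
  · exact hF'.perimeter_union_ne_of_pos hN hs hst hm hAm hBm hAB (le_max_right _ _) hAR
      (Set.sdiff_subset.trans hBR') h1pos.ne' h2pos.ne' hP
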